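/- For $\beta>0$ let $\lfloor\beta\rfloor$ be the greatest integer strictly smaller than $\beta$. For $f:[0,1]\to\mathbb R$ put $$\|f\|_{C^\beta}=\|f\|_\infty+\|f^{(\lfloor\beta\rfloor)}\|_\infty+\sup_{x\ne y}\frac{|f^{(\lfloor\beta\rfloor)}(x)-f^{(\lfloor\beta\rfloor)}(y)|}{|x-y|^{\beta-\lfloor\beta\rfloor}},\qquad |f|_{\mathcal H^\beta}=\max_{1\le j<\beta}\Big(\sup_{x\in[0,1]}\frac{|f^{(j)}(x)|^\beta}{|f(x)|^{\beta-j}}\Big)^{1/j}$$ (with $0/0=0$, and $|f|_{\mathcal H^\beta}=0$ if $\beta\le1$), let $\|f\|_{\mathcal H^\beta}=\|f\|_{C^\beta}+|f|_{\mathcal H^\beta}$, and let $\mathcal H^\beta$ be the set of functions $f\ge0$ on $[0,1]$ for which $f^{(\lfloor\beta\rfloor)}$ exists and $\|f\|_{\mathcal H^\beta}<\infty$. For $f\in\mathcal H^\beta$ and $n\ge1$ let $P_f=P_f^n$ be the law of the path $(Y_t)_{t\in[0,1]}$ observed in the Gaussian white noise model $$dY_t=2\sqrt{f(t)}\,dt+n^{-1/2}\,dW_t,\quad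 t\in[0,1],\quad Y_0=0,$$ with $W$ a standard Brownian motion, write $\operatorname{KL}(f,g)$ for the Kullback-Leibler divergence of $P_f$ from $P_g$, and let $$r^P_{n,\beta}(f(x))=n^{-\frac{\beta}{\beta+1}}\vee\Big(\frac{f(x)}{n}\Big)^{\frac{\beta}{2\beta+1}}.$$ Theorem. Let $\beta>0$, $R>0$ and $0\le\rho<R$. There is a constant $C=C(\beta,R,\rho)>0$ such that for every $x_0\in[0,1]$ and every sequence $(f_n^*)_n$ in $\mathcal H^\beta$ with $\limsup_{n\to\infty}\|f_n^*\|_{\mathcal H^\beta}\le\rho$, $$\liminf_{n\to\infty}\ \inf_{\hat f_n(x_0)}\ \sup_{\substack{f\in\mathcal H^\beta:\ \|f\|_{\mathcal H^\beta}\le R\\ \operatorname{KL}(f,f_n^*)\le1}}\ P_f\left(\frac{|\hat f_n(x_0)-f(x_0)|}{r^P_{n,\beta}(f(x_0))}\ge C\right)>0,$$ where the infimum is over all measurable estimators of $f(x_0)$ based on the path $(Y_t)_{t\in[0,1]}$. -/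

import Mathlib

open MeasureTheory ProbabilityTheory InformationTheory Filter Set
open scoped ENNReal NNReal

noncomputable section

/-- The greatest integer strictly smaller than `β` (for `β > 0`). -/
def strictFloor (β : ℝ) : ℕ := ⌈β⌉₊ - 1

/-- The supremum norm over `[0,1]`, with values in `[0,∞]`. -/
def supNorm (g : ℝ → ℝ) : ℝ≥0∞ := ⨆ x ∈ Icc (0 : ℝ) 1, ‖g x‖ₑ

/-- The `j`-th derivative of a function on `[0,1]` (one-sided at the end points). -/
def derivI (j : ℕ) (f : ℝ → ℝ) : ℝ → ℝ := iteratedDerivWithin j f (Icc (0 : ℝ) 1)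

/-- The Hölder seminorm `|f|_{C^β}` on `[0,1]`, with values in `[0,∞]`. -/
def holderSeminorm (β : ℝ) (f : ℝ → ℝ) : ℝ≥0∞ :=
  ⨆ x ∈ Icc (0 : ℝ) 1, ⨆ y ∈ Icc (0 : ℝ) 1, ⨆ _ : x ≠ y,
    ENNReal.ofReal (|derivI (strictFloor β) f x - derivI (strictFloor β) f y| /
      |x - y| ^ (β - (strictFloor β : ℝ)))

/-- `‖f‖_{C^β} = ‖f‖_∞ + ‖f^{(⌊β⌋)}‖_∞ + |f|_{C^β}`, where `⌊β⌋` is `strictFloor β`. -/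
def holderNorm (β : ℝ) (f : ℝ → ℝ) : ℝ≥0∞ :=
  supNorm f + supNorm (derivI (strictFloor β) f) + holderSeminorm β f

/-- The flatness seminorm `|f|_{H^β}`. Division in `ℝ≥0∞` satisfies `0 / 0 = 0` and `a / 0 = ∞`
for `a ≠ 0`; the maximum over the empty set (the case `β ≤ 1`) is `0`. -/
def flatSeminorm (β : ℝ) (f : ℝ → ℝ) : ℝ≥0∞ :=
  ⨆ (j : ℕ) (_ : 1 ≤ j) (_ : (j : ℝ) < β),
    (⨆ x ∈ Icc (0 : ℝ) 1, ‖derivI j f x‖ₑ ^ β / ‖f x‖ₑ ^ (β - (j : ℝ))) ^ (1 / (j : ℝ))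

/-- `‖f‖_{H^β} = ‖f‖_{C^β} + |f|_{H^β}`. -/
def flatNorm (β : ℝ) (f : ℝ → ℝ) : ℝ≥0∞ := holderNorm β f + flatSeminorm β f

/-- The space `H^β` of non-negative flat `β`-Hölder functions on `[0,1]`. Functions are represented
by maps on the line of which only the values on `[0,1]` are used. -/
def FlatHolder (β : ℝ) : Set (ℝ → ℝ) :=
  {f | ContDiffOn ℝ (strictFloor β : ℕ) f (Icc (0 : ℝ) 1) ∧
    (∀ x ∈ Icc (0 : ℝ) 1, 0 ≤ f x) ∧ flatNorm β f < ∞}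

/-- The observed path `Y_t = ∫_0^t 2 √(f(s)) ds + n^{-1/2} W_t`, `t ∈ [0,1]`. -/
def observation {Ω : Type*} (W : ℝ≥0 → Ω → ℝ) (n : ℕ) (f : ℝ → ℝ) (ω : Ω) :
    Icc (0 : ℝ) 1 → ℝ :=
  fun t => (∫ s in (0 : ℝ)..(t : ℝ), 2 * √(f s)) +
    (n : ℝ) ^ (-(1 / 2) : ℝ) * W ⟨(t : ℝ), t.2.1⟩ ω

/-- The law `P_f` of the observed path, on the path space with the `σ`-algebra generated by the
coordinates. -/
def observationLaw {Ω : Type*} [MeasurableSpace Ω] (P : Measure Ω) (W : ℝ≥0 → Ω → ℝ)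
    (n : ℕ) (f : ℝ → ℝ) : Measure (Icc (0 : ℝ) 1 → ℝ) :=
  P.map (observation W n f)

/-- The rate `n^{-β/(β+1)} ∨ (v/n)^{β/(2β+1)}` at a function value `v`. -/
def localRate (n : ℕ) (β v : ℝ) : ℝ :=
  max ((n : ℝ) ^ (-(β / (β + 1)))) ((v / n) ^ (β / (2 * β + 1)))

/-- The local parameter space `{f : ‖f‖_{H^β} ≤ R, KL(P_f, P_g) ≤ 1}`. -/
def localClass {Ω : Type*} [MeasurableSpace Ω] (P : Measure Ω) (W : ℝ≥0 → Ω → ℝ)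
    (n : ℕ) (β R : ℝ) (g : ℝ → ℝ) : Set (ℝ → ℝ) :=
  {f | f ∈ FlatHolder β ∧ flatNorm β f ≤ ENNReal.ofReal R ∧
    klDiv (observationLaw P W n f) (observationLaw P W n g) ≤ 1}

/-- The local minimax risk: the infimum over all measurable estimators of the worst-case
probability that the error at `x₀` is at least `C` times the rate. -/
def localMinimaxRisk {Ω : Type*} [MeasurableSpace Ω] (P : Measure Ω) (W : ℝ≥0 → Ω → ℝ)
    (n : ℕ) (β R C x₀ : ℝ) (g : ℝ → ℝ) : ℝ≥0∞ :=
  ⨅ (est : (Icc (0 : ℝ) 1 → ℝ) → ℝ) (_ : Measurable est),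
    ⨆ f ∈ localClass P W n β R g,
      observationLaw P W n f {y | C ≤ |est y - f x₀| / localRate n β (f x₀)}

end

/-!
The lower bound comes from a two-point comparison of `f = fₙ*` with a local perturbation `g` of it.

*Probability.* A Gaussian process `W` shifted by the covariances with a variable `Z` of its closed
linear span is the same function of `(Z + Var Z, Y)` as `W` is of `(Z, Y)`, where `Y` is independent
of `Z`. Data processing thus bounds the divergence of the two path laws by that of two
one-dimensional Gaussian laws (`klDiv_map_add_le`). With the Wiener integral for `Z`, obtained from
the isometry between Brownian motion and indicator functions (`exists_mem_closure_span_inner_eq`),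
this gives `KL(P_f, P_g) ≤ 2 n ∫ (√f - √g)²` (`klDiv_observationLaw_le`). No estimator can tell apart
two laws at divergence at most one (`ofReal_exp_neg_four_le_max`).

*Analysis.* The alternative is `g = f + γ δ ^ β K ((· - x₀) / δ)` with a bump function `K` that is
itself flat, a high power of a smooth bump (`exists_flat_bump`). The flat norm is subadditive
(`flatNorm_add_le`) and bounded along this rescaling (`exists_scaled_flat_bump`), so a small `γ`
keeps `g` in the ball of radius `R`. Let `v` be the larger of `f x₀` and `n ^ (-β / (β + 1))`, and let
`δ` be of order `(v / n) ^ (1 / (2 β + 1))`, so that `δ ^ β` has the order of the rate. If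
`f x₀` is below the threshold, `(√g - √f)² ≤ g - f` bounds the divergence. Otherwise flatness keeps
`f` of order `v` on the support of the perturbation (`exists_lower_bound_of_flatNorm_le`), and
`(√g - √f)² ≤ (g - f)² / (4 f)` does.
-/

open scoped RealInnerProductSpace Topology

/-! ### Kullback-Leibler divergence -/

/-- The convex function `klFun x = x log x + 1 - x` lies above its tangent at `M`. -/
theorem mul_log_sub_le_klFun {M x : ℝ} (hM : 0 < M) (hx : 0 ≤ x) :
    x * Real.log M - (M - 1) ≤ klFun x := by
  rcases hx.eq_or_lt with rfl | hx
  · simp [klFun]; linarith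
  have h := Real.log_le_sub_one_of_pos (div_pos hM hx)
  rw [Real.log_div hM.ne' hx.ne'] at h
  have h2 := mul_le_mul_of_nonneg_left h hx.le
  have h3 : x * (M / x - 1) = M - x := by field_simp
  rw [h3] at h2
  unfold klFun
  linarith

/-- Two laws at Kullback-Leibler divergence at most one cannot separate an event: integrating the
tangent inequality at `M = e⁴` over `A` gives `4 μ(A) - (e⁴ - 1) ν(A) ≤ KL(μ, ν)`. The set `A` need
not be measurable. -/
theorem exp_neg_four_le_of_klDiv_le_one {α : Type*} [MeasurableSpace α] {μ ν : Measure α}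
    [IsProbabilityMeasure μ] [IsProbabilityMeasure ν] (h : klDiv μ ν ≤ 1)
    {A : Set α} (hμA : 1 / 2 ≤ μ.real A) :
    Real.exp (-4) ≤ ν.real A := by
  obtain ⟨hac, hint⟩ := klDiv_ne_top_iff.1 (ne_top_of_le_ne_top ENNReal.one_ne_top h)
  have hint' : Integrable (fun x => klFun (μ.rnDeriv ν x).toReal) ν :=
    (integrable_klFun_rnDeriv_iff hac).2 hint
  have hkl : ∫ x, klFun (μ.rnDeriv ν x).toReal ∂ν ≤ 1 := by
    rw [← toReal_klDiv_eq_integral_klFun hac]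
    exact ENNReal.toReal_le_of_le_ofReal zero_le_one (by simpa using h)
  have h1 : ∫ x in A, klFun (μ.rnDeriv ν x).toReal ∂ν ≤ 1 :=
    (setIntegral_le_integral hint'
      (ae_of_all _ fun _ => klFun_nonneg ENNReal.toReal_nonneg)).trans hkl
  have hL : Integrable (fun x => (μ.rnDeriv ν x).toReal) ν := Measure.integrable_toReal_rnDeriv
  have h2 : ∫ x in A, ((μ.rnDeriv ν x).toReal * Real.log (Real.exp 4) - (Real.exp 4 - 1)) ∂ν
      ≤ ∫ x in A, klFun (μ.rnDeriv ν x).toReal ∂ν := by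
    refine setIntegral_mono ?_ hint'.integrableOn fun x =>
      mul_log_sub_le_klFun (Real.exp_pos _) ENNReal.toReal_nonneg
    exact ((hL.mul_const _).sub (integrable_const _)).integrableOn
  rw [integral_sub (hL.mul_const _).integrableOn (integrable_const _), integral_mul_const,
    Measure.setIntegral_toReal_rnDeriv hac, Real.log_exp, setIntegral_const, smul_eq_mul] at h2
  have h3 : 1 ≤ ν.real A * Real.exp 4 := by
    nlinarith [measureReal_nonneg (μ := ν) (s := A)]
  rw [Real.exp_neg]
  exact (inv_le_iff_one_le_mul₀ (Real.exp_pos 4)).2 h3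

theorem integral_exp_gaussianReal (v : ℝ≥0) :
    ∫ x, Real.exp (id x) ∂(gaussianReal 0 v) = Real.exp (v / 2) := by
  have := congrFun (mgf_id_gaussianReal (μ := 0) (v := v)) 1
  simpa [mgf] using this

/-- Translating `N(0, v)` by its own variance is the exponential tilt by the identity. -/
theorem gaussianReal_self_eq_tilted {v : ℝ≥0} (hv : v ≠ 0) :
    gaussianReal v v = (gaussianReal 0 v).tilted id := by
  rw [Measure.tilted, integral_exp_gaussianReal, gaussianReal_of_var_ne_zero _ hv,
    gaussianReal_of_var_ne_zero _ hv,
    ← withDensity_mul _ (measurable_gaussianPDF _ _) (by fun_prop)]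
  congr 1
  ext x
  simp only [Pi.mul_apply, gaussianPDF, gaussianPDFReal, id]
  rw [← ENNReal.ofReal_mul (by positivity), ← Real.exp_sub, mul_assoc (_)⁻¹, ← Real.exp_add]
  congr 3
  have : (v : ℝ) ≠ 0 := by exact_mod_cast hv
  field_simp
  ring

theorem klDiv_gaussianReal_self {v : ℝ≥0} (hv : v ≠ 0) :
    klDiv (gaussianReal v v) (gaussianReal 0 v) = ENNReal.ofReal (v / 2) := by
  have hint : Integrable (fun x : ℝ => Real.exp (id x)) (gaussianReal 0 v) := by
    simpa using integrable_exp_mul_gaussianReal (μ := 0) (v := v) 1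
  have hac : gaussianReal v v ≪ gaussianReal 0 v := by
    rw [gaussianReal_self_eq_tilted hv]
    exact tilted_absolutelyContinuous _ _
  have hllr : llr (gaussianReal v v) (gaussianReal 0 v) =ᵐ[gaussianReal v v]
      fun x => x - v / 2 := by
    refine hac.ae_le ?_
    have h := log_rnDeriv_tilted_left_self hint
    rw [← gaussianReal_self_eq_tilted hv, integral_exp_gaussianReal, Real.log_exp] at h
    exact h
  have hid : Integrable (fun x : ℝ => x) (gaussianReal v v) :=
    (memLp_id_gaussianReal 1).integrable le_rfl
  have hint2 : Integrable (llr (gaussianReal v v) (gaussianReal 0 v)) (gaussianReal v v) :=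
    (integrable_congr hllr).2 (hid.sub (integrable_const _))
  rw [klDiv_of_ac_of_integrable hac hint2, integral_congr_ae hllr,
    integral_sub hid (integrable_const _), integral_id_gaussianReal]
  congr 1
  simp
  ring

/-! ### Shifts of Gaussian processes -/

/-- Transfer of a vector between two Hilbert spaces along families with the same Gram matrix: the
functional `ξ t ↦ ⟪e, η t⟫` is represented by a vector of the closed span of `ξ`. For `ξ` the
Brownian motion and `η t` the indicator of `(0, t]` this vector is the Wiener integral of `e`. -/
theorem exists_mem_closure_span_inner_eq {T E F : Type*} [NormedAddCommGroup E]
    [InnerProductSpace ℝ E] [CompleteSpace E] [NormedAddCommGroup F] [InnerProductSpace ℝ F]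
    [CompleteSpace F] (ξ : T → E) (η : T → F) (hgram : ∀ s t, ⟪ξ s, ξ t⟫ = ⟪η s, η t⟫) (e : F) :
    ∃ Z ∈ (Submodule.span ℝ (range ξ)).topologicalClosure,
      (∀ t, ⟪Z, ξ t⟫ = ⟪e, η t⟫) ∧ ‖Z‖ ≤ ‖e‖ := by
  set G := (Submodule.span ℝ (range η)).topologicalClosure with hG
  have hGc : IsClosed (G : Set F) := Submodule.isClosed_topologicalClosure _
  have : CompleteSpace G := hGc.completeSpace_coe
  -- `e` itself need not be a limit of combinations of the `η t`, but its projection is, and has the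
  -- same inner products with them.
  set e' : F := G.starProjection e with he'
  have he'G : e' ∈ G := by simp [he']
  have hΦΨ : ∀ a b : T →₀ ℝ, ⟪Finsupp.linearCombination ℝ ξ a, Finsupp.linearCombination ℝ ξ b⟫ =
      ⟪Finsupp.linearCombination ℝ η a, Finsupp.linearCombination ℝ η b⟫ := by
    intro a b
    simp only [Finsupp.linearCombination_apply, Finsupp.sum_inner, Finsupp.inner_sum,
      real_inner_smul_left, real_inner_smul_right, hgram]
  have hnorm : ∀ a : T →₀ ℝ, ‖Finsupp.linearCombination ℝ ξ a‖ =
      ‖Finsupp.linearCombination ℝ η a‖ := by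
    intro a
    have := hΦΨ a a
    rw [real_inner_self_eq_norm_sq, real_inner_self_eq_norm_sq] at this
    exact (sq_eq_sq₀ (norm_nonneg _) (norm_nonneg _)).1 this
  have hcl : e' ∈ closure (Submodule.span ℝ (range η) : Set F) := by
    simpa [hG, ← Submodule.topologicalClosure_coe] using he'G
  obtain ⟨u, hu, hulim⟩ := mem_closure_iff_seq_limit.1 hcl
  have hex : ∀ n, ∃ a : T →₀ ℝ, Finsupp.linearCombination ℝ η a = u n := fun n => by
    have := hu n
    rw [← Finsupp.range_linearCombination] at this
    exact this
  choose a ha using hex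
  have hcau : CauchySeq (fun n => Finsupp.linearCombination ℝ ξ (a n)) := by
    have h1 : CauchySeq u := hulim.cauchySeq
    rw [Metric.cauchySeq_iff] at h1 ⊢
    intro ε hε
    obtain ⟨N, hN⟩ := h1 ε hε
    refine ⟨N, fun m hm n hn => ?_⟩
    have := hN m hm n hn
    rwa [dist_eq_norm, ← ha, ← ha, ← map_sub, ← hnorm, map_sub, ← dist_eq_norm] at this
  obtain ⟨Z, hZ⟩ := cauchySeq_tendsto_of_complete hcau
  have hξ : ∀ t, ξ t = Finsupp.linearCombination ℝ ξ (Finsupp.single t 1) := by simp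
  have hη : ∀ t, η t = Finsupp.linearCombination ℝ η (Finsupp.single t 1) := by simp
  refine ⟨Z, ?_, fun t => ?_, ?_⟩
  · refine mem_closure_of_tendsto hZ (Eventually.of_forall fun n => ?_)
    have : Finsupp.linearCombination ℝ ξ (a n) ∈ Submodule.span ℝ (range ξ) := by
      rw [← Finsupp.range_linearCombination]
      exact ⟨_, rfl⟩
    exact this
  · have h1 : Tendsto (fun n => ⟪Finsupp.linearCombination ℝ ξ (a n), ξ t⟫) atTop (𝓝 ⟪Z, ξ t⟫) :=
      hZ.inner tendsto_const_nhds
    have h2 : Tendsto (fun n => ⟪u n, η t⟫) atTop (𝓝 ⟪e', η t⟫) :=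
      hulim.inner tendsto_const_nhds
    have h3 : (fun n => ⟪Finsupp.linearCombination ℝ ξ (a n), ξ t⟫) = fun n => ⟪u n, η t⟫ := by
      funext n
      rw [hξ t, hΦΨ, ha, ← hη]
    rw [h3] at h1
    rw [tendsto_nhds_unique h1 h2, he', Submodule.inner_starProjection_left_eq_right,
      Submodule.starProjection_eq_self_iff.2]
    exact Submodule.le_topologicalClosure _ (Submodule.subset_span ⟨t, rfl⟩)
  · have h1 := hZ.norm
    have h3 : (fun n => ‖Finsupp.linearCombination ℝ ξ (a n)‖) = fun n => ‖u n‖ := by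
      funext n
      rw [hnorm, ha]
    rw [h3] at h1
    rw [tendsto_nhds_unique h1 hulim.norm]
    exact Submodule.norm_starProjection_apply_le _ _

theorem integral_norm_le_norm_Lp_two {Ω : Type*} [MeasurableSpace Ω] {P : Measure Ω}
    [IsProbabilityMeasure P] (Z : Lp ℝ 2 P) : ∫ ω, ‖Z ω‖ ∂P ≤ ‖Z‖ := by
  rw [integral_norm_eq_lintegral_enorm (Lp.aestronglyMeasurable Z), Lp.norm_def,
    ← eLpNorm_one_eq_lintegral_enorm]
  exact ENNReal.toReal_mono (Lp.eLpNorm_ne_top Z)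
    (eLpNorm_le_eLpNorm_of_exponent_le (by norm_num) (Lp.aestronglyMeasurable Z))

/-- For fixed `t`, the map `Z ↦ E exp(i t Z)` is `|t|`-Lipschitz on `L²`. -/
theorem continuous_charFun_map_Lp_two {Ω : Type*} [MeasurableSpace Ω] {P : Measure Ω}
    [IsProbabilityMeasure P] (t : ℝ) :
    Continuous fun Z : Lp ℝ 2 P => charFun (P.map Z) t := by
  have hcf : ∀ Z : Lp ℝ 2 P, charFun (P.map Z) t =
      ∫ ω, Complex.exp (Complex.I * (t * Z ω : ℝ)) ∂P := by
    intro Z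
    rw [charFun_apply_real, integral_map (Lp.aestronglyMeasurable Z).aemeasurable (by fun_prop)]
    congr 1
    ext ω
    push_cast
    ring_nf
  have hint : ∀ Z : Lp ℝ 2 P, Integrable (fun ω => Complex.exp (Complex.I * (t * Z ω : ℝ))) P := by
    intro Z
    refine Integrable.of_bound (C := 1) ?_ (ae_of_all _ fun ω => ?_)
    · have := (Lp.aestronglyMeasurable Z).aemeasurable
      exact AEMeasurable.aestronglyMeasurable (by fun_prop)
    · rw [mul_comm, Complex.norm_exp_ofReal_mul_I]
  refine LipschitzWith.continuous (K := ⟨|t|, abs_nonneg t⟩) (LipschitzWith.of_dist_le_mul ?_)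
  intro Z Y
  rw [dist_eq_norm, dist_eq_norm, hcf, hcf, ← integral_sub (hint Z) (hint Y)]
  refine (norm_integral_le_integral_norm _).trans ?_
  calc ∫ ω, ‖Complex.exp (Complex.I * (t * Z ω : ℝ)) - Complex.exp (Complex.I * (t * Y ω : ℝ))‖ ∂P
      ≤ ∫ ω, |t| * ‖(Z - Y : Lp ℝ 2 P) ω‖ ∂P := by
        refine integral_mono_ae ((hint Z).sub (hint Y)).norm
          (((Lp.memLp (Z - Y)).integrable (by norm_num)).norm.const_mul _) ?_
        filter_upwards [Lp.coeFn_sub Z Y] with ω hω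
        rw [hω, Pi.sub_apply]
        have h1 : Complex.exp (Complex.I * (t * Z ω : ℝ)) - Complex.exp (Complex.I * (t * Y ω : ℝ))
            = Complex.exp (Complex.I * (t * Y ω : ℝ)) *
              (Complex.exp (Complex.I * (t * (Z ω - Y ω) : ℝ)) - 1) := by
          rw [mul_sub, ← Complex.exp_add, mul_one]
          congr 2
          push_cast
          ring
        rw [h1, norm_mul, mul_comm Complex.I (t * Y ω : ℝ), Complex.norm_exp_ofReal_mul_I, one_mul]
        refine (Real.norm_exp_I_mul_ofReal_sub_one_le).trans ?_
        rw [norm_mul, Real.norm_eq_abs t]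
    _ = |t| * ∫ ω, ‖(Z - Y : Lp ℝ 2 P) ω‖ ∂P := integral_const_mul _ _
    _ ≤ |t| * ‖Z - Y‖ := by
        gcongr
        exact integral_norm_le_norm_Lp_two _

/-- An `L²` limit of centred Gaussian variables is a centred Gaussian variable. -/
theorem map_eq_gaussianReal_of_mem_closure {Ω : Type*} [MeasurableSpace Ω] {P : Measure Ω}
    [IsProbabilityMeasure P] {S : Set (Lp ℝ 2 P)}
    (hS : ∀ Z ∈ S, P.map Z = gaussianReal 0 (‖Z‖₊ ^ 2)) {Z : Lp ℝ 2 P} (hZ : Z ∈ closure S) :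
    P.map Z = gaussianReal 0 (‖Z‖₊ ^ 2) := by
  have : IsProbabilityMeasure (P.map Z) :=
    Measure.isProbabilityMeasure_map (Lp.aestronglyMeasurable Z).aemeasurable
  refine Measure.ext_of_charFun (funext fun t => ?_)
  have hcl : IsClosed {Z : Lp ℝ 2 P |
      charFun (P.map Z) t = charFun (gaussianReal 0 (‖Z‖₊ ^ 2)) t} := by
    refine isClosed_eq (continuous_charFun_map_Lp_two t) ?_
    have h : (fun Z : Lp ℝ 2 P => charFun (gaussianReal 0 (‖Z‖₊ ^ 2)) t) =
        fun Z => Complex.exp (-((‖Z‖ : ℂ) ^ 2 * t ^ 2 / 2)) := by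
      funext Z
      rw [charFun_gaussianReal]
      simp
    rw [h]
    fun_prop
  exact closure_minimal (fun Y hY => by rw [mem_ofPred_eq, hS Y hY]) hcl hZ

/-- Variables taken from a linear space of centred Gaussian variables (a Gaussian Hilbert space) form
a Gaussian process. -/
theorem isGaussianProcess_of_forall_mem {Ω : Type*} [MeasurableSpace Ω] {P : Measure Ω}
    (H : Submodule ℝ (Lp ℝ 2 P))
    (hH : ∀ Z ∈ H, P.map Z = gaussianReal 0 (‖Z‖₊ ^ 2)) {S : Type*} {Y : S → Ω → ℝ}
    (hY : ∀ s, ∃ Z ∈ H, Y s =ᵐ[P] Z) : IsGaussianProcess Y P := by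
  choose Z hZ hYZ using hY
  have hm : ∀ s, AEMeasurable (Y s) P := fun s =>
    (Lp.aestronglyMeasurable (Z s)).aemeasurable.congr (hYZ s).symm
  have hsum : ∀ (ι : Type _) (s : Finset ι) (c : ι → ℝ) (σ : ι → S),
      ∃ Z ∈ H, (fun ω => ∑ i ∈ s, c i * Y (σ i) ω) =ᵐ[P] Z := by
    classical
    intro ι s c σ
    induction s using Finset.induction_on with
    | empty => exact ⟨0, H.zero_mem, by simpa using! (Lp.coeFn_zero ℝ 2 P).symm⟩
    | insert i s hi ih =>
      obtain ⟨V, hV, hsV⟩ := ih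
      refine ⟨c i • Z (σ i) + V, H.add_mem (H.smul_mem _ (hZ _)) hV, ?_⟩
      filter_upwards [hsV, hYZ (σ i), Lp.coeFn_add (c i • Z (σ i)) V,
        Lp.coeFn_smul (c i) (Z (σ i))] with ω h1 h2 h3 h4
      rw [Finset.sum_insert hi, h1, h3, Pi.add_apply, h4, Pi.smul_apply, h2, smul_eq_mul]
  classical
  refine ⟨fun I => ⟨isGaussian_of_map_eq_gaussianReal fun L => ?_⟩⟩
  have hmI : AEMeasurable (fun ω => I.restrict (Y · ω)) P :=
    aemeasurable_pi_lambda _ fun i => hm i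
  obtain ⟨V, hV, hLV⟩ := hsum I Finset.univ (fun i => L (fun j => if i = j then 1 else 0))
    (fun i => i)
  refine ⟨0, ‖V‖₊ ^ 2, ?_⟩
  rw [AEMeasurable.map_map_of_aemeasurable (by fun_prop) hmI, ← hH V hV]
  refine Measure.map_congr (EventuallyEq.trans (.of_forall fun ω => ?_) hLV)
  have := LinearMap.pi_apply_eq_sum_univ L.toLinearMap (I.restrict (Y · ω))
  simpa [mul_comm] using this

/-- The closed linear span in `L²` of a centred Gaussian process consists of centred Gaussian
variables. -/
theorem map_eq_gaussianReal_of_mem_closure_span {Ω : Type*} [MeasurableSpace Ω] {P : Measure Ω}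
    [IsProbabilityMeasure P] {T : Type*} {X : T → Ω → ℝ}
    (hX : IsGaussianProcess X P) (hX0 : ∀ t, P[X t] = 0) (hX2 : ∀ t, MemLp (X t) 2 P)
    {Z : Lp ℝ 2 P}
    (hZ : Z ∈ (Submodule.span ℝ (range fun t => (hX2 t).toLp (X t))).topologicalClosure) :
    P.map Z = gaussianReal 0 (‖Z‖₊ ^ 2) := by
  refine map_eq_gaussianReal_of_mem_closure
    (S := Submodule.span ℝ (range fun t => (hX2 t).toLp (X t))) (fun Y hY => ?_)
    (by rwa [← Submodule.topologicalClosure_coe])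
  rw [SetLike.mem_coe, ← Finsupp.range_linearCombination] at hY
  obtain ⟨a, rfl⟩ := hY
  set Y := Finsupp.linearCombination ℝ (fun t => (hX2 t).toLp (X t)) a with hYdef
  have hYae : ∀ s : Finset T, (fun ω => ∑ t ∈ s, a t * X t ω) =ᵐ[P]
      ((∑ t ∈ s, a t • (hX2 t).toLp (X t) : Lp ℝ 2 P) : Ω → ℝ) := by
    classical
    intro s
    induction s using Finset.induction_on with
    | empty => simpa using! (Lp.coeFn_zero ℝ 2 P).symm
    | insert i s hi ih =>
      rw [Finset.sum_insert hi]
      filter_upwards [ih, (hX2 i).coeFn_toLp, Lp.coeFn_add (a i • (hX2 i).toLp (X i))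
        (∑ t ∈ s, a t • (hX2 t).toLp (X t)), Lp.coeFn_smul (a i) ((hX2 i).toLp (X i))]
        with ω h1 h2 h3 h4
      rw [Finset.sum_insert hi, h1, h3, Pi.add_apply, h4, Pi.smul_apply, h2, smul_eq_mul]
  have hae := hYae a.support
  have hYs : (∑ t ∈ a.support, a t • (hX2 t).toLp (X t) : Lp ℝ 2 P) = Y := by
    rw [hYdef, Finsupp.linearCombination_apply, Finsupp.sum]
  rw [hYs] at hae
  have hG : HasGaussianLaw (fun ω => ∑ t ∈ a.support, a t * X t ω) P := by
    have := (hX.smul a).hasGaussianLaw_fun_sum (I := a.support)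
    simpa using this
  have hG' : HasGaussianLaw (Y : Ω → ℝ) P := hG.congr hae
  have hmean : P[(Y : Ω → ℝ)] = 0 := by
    rw [← integral_congr_ae hae, integral_finsetSum]
    · simp [integral_const_mul, hX0]
    · exact fun t _ => ((hX2 t).integrable (by norm_num)).const_mul _
  rw [hG'.map_eq_gaussianReal, hmean]
  congr 1
  rw [variance_of_integral_eq_zero hG'.aemeasurable hmean]
  have h2 : ∫ ω, (Y ω) ^ 2 ∂P = ‖Y‖ ^ 2 := by
    rw [← real_inner_self_eq_norm_sq, L2.inner_def]
    refine integral_congr_ae (.of_forall fun ω => ?_)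
    simp [pow_two]
  rw [h2]
  ext
  simp

/-- **Cameron-Martin bound**. Shifting a centred Gaussian process by `m t = E[Z X_t]`, with `Z` in its
closed linear span, costs at most `E[Z²] / 2` in Kullback-Leibler divergence. The reason is that
`X_t = Y_t + (m t / v) Z` with `v = E[Z²]` and `Y` independent of `Z`, so that the shifted process is
the same function of `(Z + v, Y)`; by data processing it remains to compare `N(v, v)` with `N(0, v)`.
-/
theorem klDiv_map_add_le {Ω : Type*} [MeasurableSpace Ω] {P : Measure Ω}
    [IsProbabilityMeasure P] {T : Type*} {X : T → Ω → ℝ} (hXm : ∀ t, Measurable (X t))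
    (hX : IsGaussianProcess X P) (hX0 : ∀ t, P[X t] = 0) (hX2 : ∀ t, MemLp (X t) 2 P)
    {m : T → ℝ} {Z : Lp ℝ 2 P}
    (hZ : Z ∈ (Submodule.span ℝ (range fun t => (hX2 t).toLp (X t))).topologicalClosure)
    (hm : ∀ t, ⟪Z, (hX2 t).toLp (X t)⟫ = m t) :
    klDiv (P.map fun ω t => X t ω + m t) (P.map fun ω t => X t ω) ≤
      ENNReal.ofReal (‖Z‖ ^ 2 / 2) := by
  set H := (Submodule.span ℝ (range fun t => (hX2 t).toLp (X t))).topologicalClosure with hH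
  have hHG : ∀ V ∈ H, P.map V = gaussianReal 0 (‖V‖₊ ^ 2) := fun V hV =>
    map_eq_gaussianReal_of_mem_closure_span hX hX0 hX2 hV
  have hXmeas : Measurable fun ω t => X t ω := measurable_pi_lambda _ hXm
  have : IsProbabilityMeasure (P.map fun ω t => X t ω) :=
    Measure.isProbabilityMeasure_map hXmeas.aemeasurable
  -- The decomposition divides by the variance of `Z`; if it vanishes, so does the shift.
  by_cases hZ0 : Z = 0
  · have hm0 : ∀ t, m t = 0 := fun t => by rw [← hm, hZ0, inner_zero_left]
    simp only [hm0, add_zero]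
    rw [klDiv_self]
    exact zero_le
  set v : ℝ≥0 := ‖Z‖₊ ^ 2 with hv
  have hv0 : v ≠ 0 := by simpa [hv] using hZ0
  have hv0' : (v : ℝ) ≠ 0 := by exact_mod_cast hv0
  have hvZ : (v : ℝ) = ‖Z‖ ^ 2 := by simp [hv]
  have hzm : Measurable (Z : Ω → ℝ) := (Lp.stronglyMeasurable Z).measurable
  set Y : T → Ω → ℝ := fun t ω => X t ω - m t / v * Z ω with hY
  have hYm : ∀ t, Measurable (Y t) := fun t => (hXm t).sub (hzm.const_mul _)
  have hξ : ∀ t, (hX2 t).toLp (X t) ∈ H := fun t =>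
    Submodule.le_topologicalClosure _ (Submodule.subset_span ⟨t, rfl⟩)
  have hYH : ∀ t, ((hX2 t).toLp (X t) - (m t / v) • Z) ∈ H := fun t =>
    H.sub_mem (hξ t) (H.smul_mem _ hZ)
  have hYae : ∀ t, Y t =ᵐ[P] (((hX2 t).toLp (X t) - (m t / v) • Z : Lp ℝ 2 P) : Ω → ℝ) := by
    intro t
    filter_upwards [(hX2 t).coeFn_toLp, Lp.coeFn_sub ((hX2 t).toLp (X t)) ((m t / v) • Z),
      Lp.coeFn_smul (m t / v) Z] with ω h1 h2 h3
    rw [h2, Pi.sub_apply, h1, h3, Pi.smul_apply, smul_eq_mul]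
  have hgp : IsGaussianProcess (Sum.elim Y fun _ : Unit => (Z : Ω → ℝ)) P := by
    refine isGaussianProcess_of_forall_mem H hHG ?_
    rintro (t | _)
    · exact ⟨_, hYH t, hYae t⟩
    · exact ⟨Z, hZ, EventuallyEq.rfl⟩
  have hZint : P[(Z : Ω → ℝ)] = 0 := by
    have := integral_id_gaussianReal (μ := 0) (v := v)
    rw [← hHG Z hZ, integral_map hzm.aemeasurable (by fun_prop)] at this
    exact this
  have hcov : ∀ t, ∀ _ : Unit, cov[Y t, (Z : Ω → ℝ); P] = 0 := by
    intro t _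
    have hYL : MemLp (Y t) 2 P := (memLp_congr_ae (hYae t)).2 (Lp.memLp _)
    rw [covariance_eq_sub hYL (Lp.memLp Z), hZint, mul_zero, sub_zero]
    have h1 : ∫ ω, (Y t * (Z : Ω → ℝ)) ω ∂P = ⟪((hX2 t).toLp (X t) - (m t / v) • Z), Z⟫ := by
      rw [L2.inner_def]
      refine integral_congr_ae ?_
      filter_upwards [hYae t] with ω h
      rw [Pi.mul_apply, h]
      simp [mul_comm]
    rw [h1, inner_sub_left, real_inner_smul_left, real_inner_self_eq_norm_sq, real_inner_comm, hm,
      ← hvZ, div_mul_cancel₀ _ hv0', sub_self]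
  have hind := hgp.indepFun_of_covariance_eq_zero (fun t => (hYm t).aemeasurable)
    (fun _ => hzm.aemeasurable) hcov
  have hind1 : IndepFun (Z : Ω → ℝ) (fun ω t => Y t ω) P :=
    (hind.comp measurable_id (measurable_pi_apply ())).symm
  have hind2 : IndepFun (fun ω => Z ω + v) (fun ω t => Y t ω) P :=
    hind1.comp (φ := fun x : ℝ => x + v) (ψ := id) (measurable_id.add_const _) measurable_id
  have hYmeas : Measurable fun ω t => Y t ω := measurable_pi_lambda _ hYm
  set ν := P.map fun ω t => Y t ω with hν
  have hνp : IsProbabilityMeasure ν := Measure.isProbabilityMeasure_map hYmeas.aemeasurable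
  have hl1 : P.map (fun ω => ((Z ω : ℝ), fun t => Y t ω)) = (gaussianReal 0 v).prod ν := by
    rw [(indepFun_iff_map_prod_eq_prod_map_map hzm.aemeasurable hYmeas.aemeasurable).1 hind1,
      hHG Z hZ]
  have hl2 : P.map (fun ω => ((Z ω + v : ℝ), fun t => Y t ω)) = (gaussianReal v v).prod ν := by
    rw [(indepFun_iff_map_prod_eq_prod_map_map (hzm.add_const _).aemeasurable
      hYmeas.aemeasurable).1 hind2]
    have h := gaussianReal_map_add_const (μ := 0) (v := v) (v : ℝ)
    rw [← hHG Z hZ, Measure.map_map (by fun_prop) hzm, zero_add] at h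
    rw [← h]
    rfl
  set Φ : ℝ × (T → ℝ) → T → ℝ := fun p t => p.2 t + m t / v * p.1 with hΦ
  have hΦm : Measurable Φ := by
    refine measurable_pi_lambda _ fun t => ?_
    exact ((measurable_pi_apply t).comp measurable_snd).add (measurable_fst.const_mul _)
  have e1 : P.map (fun ω t => X t ω) = ((gaussianReal 0 v).prod ν).map Φ := by
    rw [← hl1, Measure.map_map hΦm (hzm.prodMk hYmeas)]
    congr 1
    funext ω t
    simp [hΦ, hY]
  have e2 : P.map (fun ω t => X t ω + m t) = ((gaussianReal v v).prod ν).map Φ := by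
    rw [← hl2, Measure.map_map hΦm ((hzm.add_const _).prodMk hYmeas)]
    congr 1
    funext ω t
    simp only [hΦ, hY, Function.comp_apply]
    field_simp
    ring
  rw [e1, e2]
  refine (klDiv_map_le _ _ hΦm).trans ?_
  rw [← Measure.compProd_const, ← Measure.compProd_const, klDiv_compProd_left,
    klDiv_gaussianReal_self hv0, hvZ]

/-- The Cameron-Martin bound for Brownian motion on `[0, 1]`: the shift `∫₀ᵗ e` costs at most
`‖e‖² / 2`. -/
theorem klDiv_map_add_integral_le {Ω : Type*} [MeasurableSpace Ω] {P : Measure Ω}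
    [IsProbabilityMeasure P] {W : ℝ≥0 → Ω → ℝ} (hWm : ∀ t, Measurable (W t))
    (hW : IsPreBrownianReal W P) {e : ℝ → ℝ} (he : MemLp e 2 volume) :
    klDiv (P.map fun ω (t : Icc (0 : ℝ) 1) => W ⟨t, t.2.1⟩ ω + ∫ s in (0 : ℝ)..t, e s)
      (P.map fun ω (t : Icc (0 : ℝ) 1) => W ⟨t, t.2.1⟩ ω) ≤
      ENNReal.ofReal ((∫ s, e s ^ 2) / 2) := by
  set X : Icc (0 : ℝ) 1 → Ω → ℝ := fun t => W ⟨t, t.2.1⟩ with hXdef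
  have hX : IsGaussianProcess X P := hW.isGaussianProcess.comp_right _
  have hX0 : ∀ t, P[X t] = 0 := fun t => hW.integral_eval _
  have hX2 : ∀ t, MemLp (X t) 2 P := fun t => (hX.hasGaussianLaw_eval t).memLp_two
  have hvol : ∀ t : Icc (0 : ℝ) 1, volume (Ioc (0 : ℝ) t) ≠ ∞ := fun t => by simp
  let η : Icc (0 : ℝ) 1 → Lp ℝ 2 (volume : Measure ℝ) := fun t =>
    indicatorConstLp 2 measurableSet_Ioc (hvol t) 1
  have hgram : ∀ s t, ⟪(hX2 s).toLp (X s), (hX2 t).toLp (X t)⟫ = ⟪η s, η t⟫ := by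
    intro s t
    have h1 : ⟪(hX2 s).toLp (X s), (hX2 t).toLp (X t)⟫ = cov[X s, X t; P] := by
      rw [covariance_eq_sub (hX2 s) (hX2 t), hX0, zero_mul, sub_zero, L2.inner_def]
      refine integral_congr_ae ?_
      filter_upwards [(hX2 s).coeFn_toLp, (hX2 t).coeFn_toLp] with ω h1 h2
      rw [h1, h2]
      simp [mul_comm]
    refine h1.trans ((hW.covariance_eval ⟨s, s.2.1⟩ ⟨t, t.2.1⟩).trans ?_)
    rw [L2.inner_indicatorConstLp_indicatorConstLp _ _ (hvol s) (hvol t)]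
    have : Ioc (0 : ℝ) s ∩ Ioc (0 : ℝ) t = Ioc 0 (min (s : ℝ) t) := by
      rw [Ioc_inter_Ioc, sup_idem]
    rw [this, Real.volume_real_Ioc_of_le (le_min s.2.1 t.2.1)]
    simpa using! NNReal.coe_min ⟨s, s.2.1⟩ ⟨t, t.2.1⟩
  obtain ⟨Z, hZ, hZm, hZn⟩ := exists_mem_closure_span_inner_eq
    (fun t => (hX2 t).toLp (X t)) η hgram (he.toLp e)
  have hm : ∀ t, ⟪Z, (hX2 t).toLp (X t)⟫ = ∫ s in (0 : ℝ)..t, e s := by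
    intro t
    rw [hZm t, real_inner_comm, L2.inner_indicatorConstLp_one, intervalIntegral.integral_of_le t.2.1]
    exact integral_congr_ae (ae_restrict_of_ae he.coeFn_toLp)
  refine (klDiv_map_add_le (fun t => hWm _) hX hX0 hX2 hZ hm).trans ?_
  refine ENNReal.ofReal_le_ofReal ?_
  have h2 : ∫ s, e s ^ 2 = ‖he.toLp e‖ ^ 2 := by
    rw [← real_inner_self_eq_norm_sq, L2.inner_def]
    refine integral_congr_ae ?_
    filter_upwards [he.coeFn_toLp] with s h
    rw [h]
    simp [pow_two]
  rw [h2]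
  gcongr

/-- The divergence in the white noise model, at most `2 n ∫ (√f - √g)²` (this is in fact its exact
value). -/
theorem klDiv_observationLaw_le {Ω : Type*} [MeasurableSpace Ω] {P : Measure Ω}
    [IsProbabilityMeasure P] {W : ℝ≥0 → Ω → ℝ} (hWm : ∀ t, Measurable (W t))
    (hW : IsPreBrownianReal W P) {n : ℕ} (hn : n ≠ 0) {f g : ℝ → ℝ}
    (hf : ContinuousOn f (Icc 0 1)) (hg : ContinuousOn g (Icc 0 1)) :
    klDiv (observationLaw P W n f) (observationLaw P W n g) ≤
      ENNReal.ofReal (2 * n * ∫ s in Icc (0 : ℝ) 1, (√(f s) - √(g s)) ^ 2) := by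
  have hn0 : (0 : ℝ) < n := by exact_mod_cast Nat.pos_of_ne_zero hn
  set d : ℝ → ℝ := fun s => √n * (2 * √(f s) - 2 * √(g s)) with hd
  have hdc : ContinuousOn d (Icc 0 1) := by fun_prop
  set e : ℝ → ℝ := (Icc (0 : ℝ) 1).indicator d with he
  have heL : MemLp e 2 volume := by
    rw [he, memLp_indicator_iff_restrict measurableSet_Icc,
      memLp_two_iff_integrable_sq (hdc.aestronglyMeasurable measurableSet_Icc)]
    exact (hdc.pow 2).integrableOn_compact isCompact_Icc
  have heint : ∫ s, e s ^ 2 = 2 * (2 * n * ∫ s in Icc (0 : ℝ) 1, (√(f s) - √(g s)) ^ 2) := by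
    have h1 : (fun s => e s ^ 2) = (Icc (0 : ℝ) 1).indicator fun s => d s ^ 2 := by
      funext s
      by_cases hs : s ∈ Icc (0 : ℝ) 1 <;> simp [he, hs]
    rw [h1, integral_indicator measurableSet_Icc, ← integral_const_mul, ← integral_const_mul]
    congr 1
    funext s
    rw [hd]
    dsimp only
    rw [mul_pow, Real.sq_sqrt hn0.le]
    ring
  -- Up to the affine map `Ψ` below, the drift difference `2 √f - 2 √g` is the shift `e` of `W`: the
  -- factor `√n` compensates the noise level.
  have h := klDiv_map_add_integral_le hWm hW heL
  rw [heint, mul_div_cancel_left₀ _ two_ne_zero] at h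
  set σ : ℝ := (n : ℝ) ^ (-(1 / 2) : ℝ) with hσ
  have hσn : σ * √n = 1 := by
    rw [hσ, Real.sqrt_eq_rpow, ← Real.rpow_add hn0]
    simp
  set Ψ : (Icc (0 : ℝ) 1 → ℝ) → Icc (0 : ℝ) 1 → ℝ := fun y t =>
    (∫ s in (0 : ℝ)..t, 2 * √(g s)) + σ * y t with hΨ
  have hΨm : Measurable Ψ := measurable_pi_lambda _ fun t =>
    ((measurable_pi_apply t).const_mul _).const_add _
  have hm1 : Measurable fun ω (t : Icc (0 : ℝ) 1) => W ⟨t, t.2.1⟩ ω :=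
    measurable_pi_lambda _ fun t => hWm _
  have hm2 : Measurable fun ω (t : Icc (0 : ℝ) 1) => W ⟨t, t.2.1⟩ ω + ∫ s in (0 : ℝ)..t, e s :=
    measurable_pi_lambda _ fun t => (hWm _).add_const _
  have hg' : observationLaw P W n g =
      (P.map fun ω (t : Icc (0 : ℝ) 1) => W ⟨t, t.2.1⟩ ω).map Ψ := by
    rw [Measure.map_map hΨm hm1]
    rfl
  have hf' : observationLaw P W n f =
      (P.map fun ω (t : Icc (0 : ℝ) 1) => W ⟨t, t.2.1⟩ ω + ∫ s in (0 : ℝ)..t, e s).map Ψ := by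
    rw [Measure.map_map hΨm hm2, observationLaw]
    congr 1
    funext ω t
    have hsub : Icc (0 : ℝ) t ⊆ Icc 0 1 := Icc_subset_Icc le_rfl t.2.2
    have hI : ∀ {u : ℝ → ℝ}, ContinuousOn u (Icc 0 1) →
        IntervalIntegrable (fun s => 2 * √(u s)) volume 0 t := fun {u} hu => by
      refine ContinuousOn.intervalIntegrable ?_
      rw [uIcc_of_le t.2.1]
      have := hu.mono hsub
      fun_prop
    have he1 : ∫ s in (0 : ℝ)..t, e s = √n * ((∫ s in (0 : ℝ)..t, 2 * √(f s)) -
        ∫ s in (0 : ℝ)..t, 2 * √(g s)) := by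
      rw [← intervalIntegral.integral_sub (hI hf) (hI hg), ← intervalIntegral.integral_const_mul]
      refine intervalIntegral.integral_congr fun s hs => ?_
      rw [uIcc_of_le t.2.1] at hs
      simp only [he, indicator_of_mem (hsub hs), hd]
    simp only [observation, hΨ, Function.comp_apply, he1]
    rw [mul_add, ← mul_assoc σ, hσn]
    ring
  rw [hf', hg']
  exact (klDiv_map_le _ _ hΨm).trans h

/-! ### The flat Hölder norm -/

theorem le_strictFloor {β : ℝ} {j : ℕ} (hj : (j : ℝ) < β) : j ≤ strictFloor β := by
  unfold strictFloor
  have : j < ⌈β⌉₊ := Nat.lt_ceil.2 hj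
  omega

theorem strictFloor_lt {β : ℝ} (hβ : 0 < β) : (strictFloor β : ℝ) < β := by
  have h : 0 < ⌈β⌉₊ := Nat.ceil_pos.2 hβ
  exact Nat.lt_ceil.1 (show strictFloor β < ⌈β⌉₊ by unfold strictFloor; omega)

theorem le_strictFloor_add_one {β : ℝ} (hβ : 0 < β) : β ≤ strictFloor β + 1 := by
  have h : 0 < ⌈β⌉₊ := Nat.ceil_pos.2 hβ
  have h2 : ⌈β⌉₊ = strictFloor β + 1 := by unfold strictFloor; omega
  exact_mod_cast h2 ▸ Nat.le_ceil β

theorem derivI_add {k j : ℕ} (hj : j ≤ k) {f g : ℝ → ℝ} (hf : ContDiffOn ℝ k f (Icc 0 1))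
    (hg : ContDiffOn ℝ k g (Icc 0 1)) {x : ℝ} (hx : x ∈ Icc (0 : ℝ) 1) :
    derivI j (fun y => f y + g y) x = derivI j f x + derivI j g x :=
  iteratedDerivWithin_fun_add hx (uniqueDiffOn_Icc zero_lt_one)
    ((hf x hx).of_le (by exact_mod_cast hj)) ((hg x hx).of_le (by exact_mod_cast hj))

theorem enorm_le_supNorm (f : ℝ → ℝ) {x : ℝ} (hx : x ∈ Icc (0 : ℝ) 1) : ‖f x‖ₑ ≤ supNorm f :=
  le_iSup₂_of_le x hx le_rfl

theorem supNorm_le_add {f g h : ℝ → ℝ} (H : ∀ x ∈ Icc (0 : ℝ) 1, h x = f x + g x) :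
    supNorm h ≤ supNorm f + supNorm g := by
  refine iSup₂_le fun x hx => ?_
  rw [H x hx]
  exact (enorm_add_le _ _).trans (add_le_add (enorm_le_supNorm f hx) (enorm_le_supNorm g hx))

theorem ofReal_le_holderSeminorm (β : ℝ) (f : ℝ → ℝ) {x y : ℝ} (hx : x ∈ Icc (0 : ℝ) 1)
    (hy : y ∈ Icc (0 : ℝ) 1) (hxy : x ≠ y) :
    ENNReal.ofReal (|derivI (strictFloor β) f x - derivI (strictFloor β) f y| /
      |x - y| ^ (β - (strictFloor β : ℝ))) ≤ holderSeminorm β f :=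
  le_iSup₂_of_le x hx <| le_iSup₂_of_le y hy <| le_iSup_of_le hxy le_rfl

theorem holderSeminorm_add_le {β : ℝ} {f g : ℝ → ℝ}
    (hf : ContDiffOn ℝ (strictFloor β : ℕ) f (Icc 0 1))
    (hg : ContDiffOn ℝ (strictFloor β : ℕ) g (Icc 0 1)) :
    holderSeminorm β (fun x => f x + g x) ≤ holderSeminorm β f + holderSeminorm β g := by
  refine iSup₂_le fun x hx => iSup₂_le fun y hy => iSup_le fun hxy => ?_
  refine le_trans ?_ (add_le_add (ofReal_le_holderSeminorm β f hx hy hxy)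
    (ofReal_le_holderSeminorm β g hx hy hxy))
  rw [← ENNReal.ofReal_add (by positivity) (by positivity), derivI_add le_rfl hf hg hx,
    derivI_add le_rfl hf hg hy, ← add_div, add_sub_add_comm]
  gcongr
  exact abs_add_le _ _

theorem holderNorm_add_le {β : ℝ} {f g : ℝ → ℝ}
    (hf : ContDiffOn ℝ (strictFloor β : ℕ) f (Icc 0 1))
    (hg : ContDiffOn ℝ (strictFloor β : ℕ) g (Icc 0 1)) :
    holderNorm β (fun x => f x + g x) ≤ holderNorm β f + holderNorm β g := by
  have h1 : supNorm (fun x => f x + g x) ≤ supNorm f + supNorm g :=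
    supNorm_le_add fun _ _ => rfl
  have h2 : supNorm (derivI (strictFloor β) fun x => f x + g x) ≤
      supNorm (derivI (strictFloor β) f) + supNorm (derivI (strictFloor β) g) :=
    supNorm_le_add fun _ hx => derivI_add le_rfl hf hg hx
  have h3 := holderSeminorm_add_le hf hg
  unfold holderNorm
  calc _ ≤ _ := add_le_add (add_le_add h1 h2) h3
    _ = _ := by ring

/-- The flatness seminorm without quotients and roots. -/
theorem flatSeminorm_le_iff {β : ℝ} {f : ℝ → ℝ} {M : ℝ≥0∞} (hM : M ≠ ∞) :
    flatSeminorm β f ≤ M ↔ ∀ j : ℕ, 1 ≤ j → (j : ℝ) < β → ∀ x ∈ Icc (0 : ℝ) 1,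
      ‖derivI j f x‖ₑ ^ β ≤ M ^ j * ‖f x‖ₑ ^ (β - (j : ℝ)) := by
  unfold flatSeminorm
  simp only [iSup_le_iff]
  refine forall_congr' fun j => forall_congr' fun hj => forall_congr' fun hjβ => ?_
  have hj0 : (0 : ℝ) < j := by exact_mod_cast hj
  rw [one_div, ENNReal.rpow_inv_le_iff hj0, ENNReal.rpow_natCast]
  simp only [iSup_le_iff]
  refine forall_congr' fun x => forall_congr' fun hx => ?_
  refine ENNReal.div_le_iff_le_mul (Or.inr (ENNReal.pow_ne_top hM)) (Or.inl ?_)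
  exact ENNReal.rpow_ne_top_of_nonneg (by linarith) enorm_ne_top

/-- Hölder's inequality for two summands: `(s, t) ↦ s ^ θ * t ^ (1 - θ)` is superadditive. -/
theorem ENNReal.rpow_mul_rpow_add_le {θ : ℝ} (h0 : 0 < θ) (h1 : θ < 1) (F G a b : ℝ≥0∞) :
    F ^ θ * a ^ (1 - θ) + G ^ θ * b ^ (1 - θ) ≤ (F + G) ^ θ * (a + b) ^ (1 - θ) := by
  have hpq : (θ⁻¹).HolderConjugate (1 - θ)⁻¹ := by
    rw [Real.holderConjugate_iff]
    exact ⟨(one_lt_inv₀ h0).2 h1, by simp⟩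
  have h := ENNReal.inner_le_Lp_mul_Lq Finset.univ ![F ^ θ, G ^ θ] ![a ^ (1 - θ), b ^ (1 - θ)] hpq
  have h2 : 1 - θ ≠ 0 := by linarith
  simpa [← ENNReal.rpow_mul, mul_inv_cancel₀ h0.ne', mul_inv_cancel₀ h2] using h

/-- The flatness seminorm is subadditive on nonnegative functions. A bound `M` on it says
`|f⁽ʲ⁾| ≤ M ^ θ * f ^ (1 - θ)` with `θ = j / β`, and such bounds add up by Hölder's inequality. -/
theorem flatSeminorm_add_le {β : ℝ} {f g : ℝ → ℝ}
    (hf : ContDiffOn ℝ (strictFloor β : ℕ) f (Icc 0 1))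
    (hg : ContDiffOn ℝ (strictFloor β : ℕ) g (Icc 0 1))
    (hf0 : ∀ x ∈ Icc (0 : ℝ) 1, 0 ≤ f x) (hg0 : ∀ x ∈ Icc (0 : ℝ) 1, 0 ≤ g x) :
    flatSeminorm β (fun x => f x + g x) ≤ flatSeminorm β f + flatSeminorm β g := by
  by_cases hF : flatSeminorm β f = ∞
  · simp [hF]
  by_cases hG : flatSeminorm β g = ∞
  · simp [hG]
  rw [flatSeminorm_le_iff (ENNReal.add_ne_top.2 ⟨hF, hG⟩)]
  intro j hj hjβ x hx
  have hj0 : (0 : ℝ) < j := by exact_mod_cast hj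
  have hβ : 0 < β := hj0.trans hjβ
  have key : ∀ {u : ℝ → ℝ}, flatSeminorm β u ≠ ∞ →
      ‖derivI j u x‖ₑ ≤ flatSeminorm β u ^ (j / β) * ‖u x‖ₑ ^ (1 - j / β) := by
    intro u hu
    have h := (flatSeminorm_le_iff hu).1 le_rfl j hj hjβ x hx
    rw [← ENNReal.rpow_le_rpow_iff hβ, ENNReal.mul_rpow_of_nonneg _ _ hβ.le, ← ENNReal.rpow_mul,
      ← ENNReal.rpow_mul, sub_mul, div_mul_cancel₀ _ hβ.ne', one_mul, ENNReal.rpow_natCast]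
    exact h
  have hsum : ‖f x + g x‖ₑ = ‖f x‖ₑ + ‖g x‖ₑ := by
    rw [Real.enorm_of_nonneg (hf0 x hx), Real.enorm_of_nonneg (hg0 x hx),
      Real.enorm_of_nonneg (add_nonneg (hf0 x hx) (hg0 x hx)),
      ENNReal.ofReal_add (hf0 x hx) (hg0 x hx)]
  rw [derivI_add (le_strictFloor hjβ) hf hg hx, hsum]
  have h := (enorm_add_le (derivI j f x) (derivI j g x)).trans <|
    (add_le_add (key hF) (key hG)).trans <|
    ENNReal.rpow_mul_rpow_add_le (div_pos hj0 hβ) ((div_lt_one hβ).2 hjβ) _ _ _ _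
  rw [← ENNReal.rpow_le_rpow_iff hβ, ENNReal.mul_rpow_of_nonneg _ _ hβ.le, ← ENNReal.rpow_mul,
      ← ENNReal.rpow_mul, sub_mul, div_mul_cancel₀ _ hβ.ne', one_mul, ENNReal.rpow_natCast] at h
  exact h

theorem flatNorm_add_le {β : ℝ} {f g : ℝ → ℝ}
    (hf : ContDiffOn ℝ (strictFloor β : ℕ) f (Icc 0 1))
    (hg : ContDiffOn ℝ (strictFloor β : ℕ) g (Icc 0 1))
    (hf0 : ∀ x ∈ Icc (0 : ℝ) 1, 0 ≤ f x) (hg0 : ∀ x ∈ Icc (0 : ℝ) 1, 0 ≤ g x) :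
    flatNorm β (fun x => f x + g x) ≤ flatNorm β f + flatNorm β g := by
  unfold flatNorm
  calc _ ≤ _ := add_le_add (holderNorm_add_le hf hg) (flatSeminorm_add_le hf hg hf0 hg0)
    _ = _ := by ring

theorem le_of_flatNorm_le {β R : ℝ} (hR : 0 ≤ R) {f : ℝ → ℝ}
    (h : flatNorm β f ≤ ENNReal.ofReal R) {x : ℝ} (hx : x ∈ Icc (0 : ℝ) 1) : f x ≤ R := by
  have h1 : ‖f x‖ₑ ≤ ENNReal.ofReal R := by
    refine le_trans ?_ h
    unfold flatNorm holderNorm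
    rw [add_assoc, add_assoc]
    exact le_add_right (enorm_le_supNorm f hx)
  rw [← ofReal_norm, ENNReal.ofReal_le_ofReal_iff hR] at h1
  exact (le_abs_self _).trans h1

theorem abs_sub_le_of_flatNorm_le {β R : ℝ} (hβ : 0 < β) (hβ1 : β ≤ 1) (hR : 0 ≤ R) {f : ℝ → ℝ}
    (h : flatNorm β f ≤ ENNReal.ofReal R) {x y : ℝ} (hx : x ∈ Icc (0 : ℝ) 1)
    (hy : y ∈ Icc (0 : ℝ) 1) : |f x - f y| ≤ R * |x - y| ^ β := by
  rcases eq_or_ne x y with rfl | hxy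
  · simp [Real.zero_rpow hβ.ne']
  have h0 : strictFloor β = 0 := by
    have : ⌈β⌉₊ ≤ 1 := Nat.ceil_le.2 (by simpa using hβ1)
    unfold strictFloor
    omega
  have h1 := ofReal_le_holderSeminorm β f hx hy hxy
  rw [h0] at h1
  simp only [derivI, iteratedDerivWithin_zero, Nat.cast_zero, sub_zero] at h1
  have h2 : holderSeminorm β f ≤ ENNReal.ofReal R := by
    refine le_trans ?_ h
    unfold flatNorm holderNorm
    exact le_add_right (le_add_left le_rfl)
  have h3 := h1.trans h2
  rw [ENNReal.ofReal_le_ofReal_iff hR, div_le_iff₀] at h3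
  · exact h3
  · exact Real.rpow_pos_of_pos (abs_pos.2 (sub_ne_zero.2 hxy)) _

theorem abs_deriv_le_of_flatNorm_le {β R : ℝ} (hβ : 1 < β) (hR : 0 ≤ R) {f : ℝ → ℝ}
    (h : flatNorm β f ≤ ENNReal.ofReal R) {x : ℝ} (hx : x ∈ Icc (0 : ℝ) 1) (hfx : 0 ≤ f x) :
    |derivWithin f (Icc 0 1) x| ≤ R ^ (1 / β) * f x ^ (1 - 1 / β) := by
  have h2 : flatSeminorm β f ≤ ENNReal.ofReal R := by
    refine le_trans ?_ h
    unfold flatNorm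
    exact le_add_left le_rfl
  have hβ0 : 0 < β := by linarith
  have h3 := (flatSeminorm_le_iff ENNReal.ofReal_ne_top).1 h2 1 le_rfl (by simpa using hβ) x hx
  rw [derivI, iteratedDerivWithin_one, ← ofReal_norm, ← ofReal_norm,
    ENNReal.ofReal_rpow_of_nonneg (norm_nonneg _) hβ0.le, pow_one, Nat.cast_one,
    ENNReal.ofReal_rpow_of_nonneg (norm_nonneg _) (by linarith), ← ENNReal.ofReal_mul hR,
    ENNReal.ofReal_le_ofReal_iff (by positivity), Real.norm_eq_abs, Real.norm_of_nonneg hfx] at h3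
  have h4 := Real.rpow_le_rpow (by positivity) h3 (inv_nonneg.2 hβ0.le)
  rw [Real.rpow_rpow_inv (abs_nonneg _) hβ0.ne', Real.mul_rpow hR (by positivity),
    ← Real.rpow_mul hfx] at h4
  convert h4 using 3
  · rw [one_div]
  · field_simp

/-- For `β > 1`, flatness makes `f ^ (1 / β)` Lipschitz: its derivative is bounded by the flatness
bound on `f'`. Since `f` may vanish, the argument is run for `(f + ε) ^ (1 / β)`. -/
theorem rpow_inv_le_of_flatNorm_le {β R : ℝ} (hβ : 1 < β) (hR : 0 ≤ R) {f : ℝ → ℝ}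
    (hf : f ∈ FlatHolder β) (h : flatNorm β f ≤ ENNReal.ofReal R) {x y : ℝ}
    (hx : x ∈ Icc (0 : ℝ) 1) (hy : y ∈ Icc (0 : ℝ) 1) :
    f x ^ (1 / β) ≤ f y ^ (1 / β) + R ^ (1 / β) * |x - y| := by
  have hβ0 : 0 < β := by linarith
  obtain ⟨hfc, hf0, -⟩ := hf
  have hdiff : DifferentiableOn ℝ f (Icc 0 1) := by
    refine hfc.differentiableOn ?_
    have : 1 ≤ strictFloor β := le_strictFloor (by simpa using hβ)
    exact_mod_cast (by omega : strictFloor β ≠ 0)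
  have hε : ∀ ε > 0, (f x + ε) ^ (1 / β) ≤ (f y + ε) ^ (1 / β) + R ^ (1 / β) * |x - y| := by
    intro ε hε
    have hd : ∀ z ∈ Icc (0 : ℝ) 1, HasDerivWithinAt (fun z => (f z + ε) ^ (1 / β))
        (derivWithin f (Icc 0 1) z * (1 / β) * (f z + ε) ^ (1 / β - 1)) (Icc 0 1) z := by
      intro z hz
      exact ((hdiff z hz).hasDerivWithinAt.add_const ε).rpow_const
        (Or.inl (by linarith [hf0 z hz]))
    have hb : ∀ z ∈ Icc (0 : ℝ) 1,
        ‖derivWithin f (Icc 0 1) z * (1 / β) * (f z + ε) ^ (1 / β - 1)‖ ≤ R ^ (1 / β) := by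
      intro z hz
      have hz0 := hf0 z hz
      have hp : 0 < f z + ε := by linarith
      have h1 := abs_deriv_le_of_flatNorm_le hβ hR h hz hz0
      have h1β : 1 / β ≤ 1 := (div_le_one hβ0).2 hβ.le
      have h2 : f z ^ (1 - 1 / β) ≤ (f z + ε) ^ (1 - 1 / β) :=
        Real.rpow_le_rpow hz0 (by linarith) (by linarith)
      rw [norm_mul, norm_mul, Real.norm_eq_abs, Real.norm_of_nonneg (by positivity : 0 ≤ 1 / β),
        Real.norm_of_nonneg (by positivity)]
      calc _ ≤ (R ^ (1 / β) * (f z + ε) ^ (1 - 1 / β)) * 1 * (f z + ε) ^ (1 / β - 1) := by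
            gcongr
            exact h1.trans (by gcongr)
        _ = R ^ (1 / β) * ((f z + ε) ^ (1 - 1 / β) * (f z + ε) ^ (1 / β - 1)) := by ring
        _ = R ^ (1 / β) := by
            rw [← Real.rpow_add hp]
            simp
    have h3 := (convex_Icc (0 : ℝ) 1).norm_image_sub_le_of_norm_hasDerivWithin_le hd hb hy hx
    rw [Real.norm_eq_abs, Real.norm_eq_abs] at h3
    linarith [le_abs_self ((f x + ε) ^ (1 / β) - (f y + ε) ^ (1 / β))]
  have hlim : ∀ a : ℝ, Tendsto (fun ε => (a + ε) ^ (1 / β)) (𝓝[>] 0) (𝓝 (a ^ (1 / β))) := by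
    intro a
    have hc : Continuous fun ε : ℝ => (a + ε) ^ (1 / β) :=
      (continuous_const.add continuous_id).rpow_const fun _ => Or.inr (by positivity)
    have := hc.tendsto 0
    rw [add_zero] at this
    exact this.mono_left nhdsWithin_le_nhds
  exact le_of_tendsto_of_tendsto (hlim (f x)) ((hlim (f y)).add_const _)
    (eventually_mem_nhdsWithin.mono hε)

/-- A flat function does not drop below a fixed fraction of `f x₀` within distance of order
`f x₀ ^ (1 / β)` of `x₀`. -/
theorem exists_lower_bound_of_flatNorm_le {β R : ℝ} (hβ : 0 < β) (hR : 0 < R) :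
    ∃ c κ : ℝ, 0 < c ∧ c ≤ 1 ∧ 0 < κ ∧ κ ≤ 1 ∧ ∀ f ∈ FlatHolder β,
      flatNorm β f ≤ ENNReal.ofReal R → ∀ x₀ ∈ Icc (0 : ℝ) 1, ∀ x ∈ Icc (0 : ℝ) 1,
        |x - x₀| ≤ c * f x₀ ^ (1 / β) → κ * f x₀ ≤ f x := by
  rcases le_or_gt β 1 with hβ1 | hβ1
  · refine ⟨min 1 ((2 * R)⁻¹ ^ (1 / β)), 1 / 2, by positivity, min_le_left _ _, by norm_num,
      by norm_num, fun f hf hfR x₀ hx₀ x hx hxx => ?_⟩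
    have hf0 := hf.2.1 x₀ hx₀
    have h1 := abs_sub_le_of_flatNorm_le hβ hβ1 hR.le hfR hx hx₀
    have h2 : |x - x₀| ^ β ≤ (2 * R)⁻¹ * f x₀ := by
      calc |x - x₀| ^ β ≤ (((2 * R)⁻¹ ^ (1 / β)) * f x₀ ^ (1 / β)) ^ β := by
            gcongr
            refine hxx.trans ?_
            gcongr
            exact min_le_right _ _
        _ = (2 * R)⁻¹ * f x₀ := by
            rw [Real.mul_rpow (by positivity) (by positivity), one_div,
              Real.rpow_inv_rpow (by positivity) hβ.ne', Real.rpow_inv_rpow hf0 hβ.ne']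
    have h3 : R * |x - x₀| ^ β ≤ f x₀ / 2 := by
      calc _ ≤ R * ((2 * R)⁻¹ * f x₀) := by gcongr
        _ = f x₀ / 2 := by field_simp
    linarith [neg_abs_le (f x - f x₀)]
  · refine ⟨min 1 (2 * R ^ (1 / β))⁻¹, (1 / 2) ^ β, by positivity, min_le_left _ _,
      by positivity, Real.rpow_le_one (by norm_num) (by norm_num) hβ.le,
      fun f hf hfR x₀ hx₀ x hx hxx => ?_⟩
    have hf0 := hf.2.1 x₀ hx₀
    have hfx := hf.2.1 x hx
    have h1 := rpow_inv_le_of_flatNorm_le hβ1 hR.le hf hfR hx₀ hx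
    have h2 : R ^ (1 / β) * |x₀ - x| ≤ f x₀ ^ (1 / β) / 2 := by
      rw [abs_sub_comm]
      calc _ ≤ R ^ (1 / β) * ((2 * R ^ (1 / β))⁻¹ * f x₀ ^ (1 / β)) := by
            gcongr
            refine hxx.trans ?_
            gcongr
            exact min_le_right _ _
        _ = f x₀ ^ (1 / β) / 2 := by field_simp
    have h3 : 1 / 2 * f x₀ ^ (1 / β) ≤ f x ^ (1 / β) := by linarith
    have h4 := Real.rpow_le_rpow (by positivity) h3 hβ.le
    rwa [Real.mul_rpow (by positivity) (by positivity), one_div β, Real.rpow_inv_rpow hf0 hβ.ne',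
      Real.rpow_inv_rpow hfx hβ.ne'] at h4

/-! ### Flat bump functions -/

section FlatBump

open scoped ContDiff

/-- The `j`-th derivative of `ψ ^ m` keeps the factor `ψ ^ (m - j)`. -/
theorem exists_iteratedDeriv_pow_eq {ψ : ℝ → ℝ} (hψ : ContDiff ℝ ∞ ψ) {m j : ℕ} (hj : j ≤ m) :
    ∃ g : ℝ → ℝ, ContDiff ℝ ∞ g ∧
      iteratedDeriv j (fun u => ψ u ^ m) = fun u => ψ u ^ (m - j) * g u := by
  induction j with
  | zero => exact ⟨fun _ => 1, contDiff_const, by simp⟩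
  | succ j ih =>
    obtain ⟨g, hg, hgj⟩ := ih (by omega)
    have hψ' : ContDiff ℝ ∞ (deriv ψ) := ContDiff.deriv' (n := ∞) hψ
    have hg' : ContDiff ℝ ∞ (deriv g) := ContDiff.deriv' (n := ∞) hg
    obtain ⟨l, hl⟩ : ∃ l, m - j = l + 1 := ⟨m - j - 1, by omega⟩
    have hl' : m - (j + 1) = l := by omega
    refine ⟨fun u => (l + 1) * deriv ψ u * g u + ψ u * deriv g u, by fun_prop, ?_⟩
    rw [iteratedDeriv_succ, hgj, hl, hl']
    funext u
    have h1 : HasDerivAt ψ (deriv ψ u) u := (hψ.differentiable (by simp) u).hasDerivAt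
    have h2 : HasDerivAt g (deriv g u) u := (hg.differentiable (by simp) u).hasDerivAt
    refine ((h1.pow (l + 1)).mul h2).deriv.trans ?_
    simp
    ring

theorem exists_abs_iteratedDeriv_pow_le {ψ : ℝ → ℝ} (hψ : ContDiff ℝ ∞ ψ) (hψ0 : ∀ u, 0 ≤ ψ u)
    (hψs : ∀ u, 1 ≤ |u| → ψ u = 0) {m j : ℕ} (hj : j < m) :
    ∃ C : ℝ, 0 ≤ C ∧ ∀ u, |iteratedDeriv j (fun u => ψ u ^ m) u| ≤ C * ψ u ^ (m - j) := by
  obtain ⟨g, hg, hgj⟩ := exists_iteratedDeriv_pow_eq hψ hj.le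
  obtain ⟨C, hC⟩ := (isCompact_Icc (a := (-1 : ℝ)) (b := 1)).exists_bound_of_continuousOn
    hg.continuous.continuousOn
  have hC0 : 0 ≤ C := (norm_nonneg _).trans (hC 0 (by simp))
  refine ⟨C, hC0, fun u => ?_⟩
  rw [hgj]
  dsimp only
  rw [abs_mul, abs_of_nonneg (pow_nonneg (hψ0 u) _), mul_comm]
  by_cases hu : 1 ≤ |u|
  · rw [hψs u hu, zero_pow (by omega), mul_zero, mul_zero]
  · have hu' := abs_le.1 (not_le.1 hu).le
    have := pow_nonneg (hψ0 u) (m - j)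
    gcongr
    exact hC u hu'

/-- A smooth bump function with finite flatness seminorm, namely a power `m ≥ β` of a standard bump
`ψ`: the `j`-th derivative is `O(ψ ^ (m - j))`, and `(m - j) β ≥ m (β - j)`. -/
theorem exists_flat_bump {β : ℝ} (hβ : 0 < β) :
    ∃ (K : ℝ → ℝ) (A : ℝ), 1 ≤ A ∧ ContDiff ℝ ∞ K ∧ (∀ u, 0 ≤ K u) ∧ (∀ u, K u ≤ 1) ∧ K 0 = 1 ∧
      (∀ u, 1 ≤ |u| → K u = 0) ∧
      (∀ j : ℕ, (j : ℝ) < β → ∀ u, |iteratedDeriv j K u| ^ β ≤ A ^ β * K u ^ (β - j)) ∧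
      ∀ u v, |iteratedDeriv (strictFloor β) K u - iteratedDeriv (strictFloor β) K v| ≤
        A * |u - v| ^ (β - strictFloor β) := by
  let ψ : ContDiffBump (0 : ℝ) := ⟨1 / 2, 1, by norm_num, by norm_num⟩
  have hψ : ContDiff ℝ ∞ ψ := ψ.contDiff
  have hψs : ∀ u, 1 ≤ |u| → ψ u = 0 := fun u hu => ψ.zero_of_le_dist (by simpa using hu)
  have hψ0 : ∀ u, 0 ≤ ψ u := fun u => ψ.nonneg
  have hψ1 : ∀ u, ψ u ≤ 1 := fun u => ψ.le_one
  set k := strictFloor β with hk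
  -- `k + 1` is the least integer with `β ≤ k + 1`; one more makes the derivative of order `k + 1`,
  -- which controls the Hölder seminorm, vanish outside the support as well.
  set m := k + 2 with hm
  have hβm : β ≤ m := by
    have := le_strictFloor_add_one hβ
    rw [hm]
    push_cast
    linarith
  have hex : ∀ j : ℕ, ∃ C : ℝ, 0 ≤ C ∧ (j < m → ∀ u,
      |iteratedDeriv j (fun u => ψ u ^ m) u| ≤ C * ψ u ^ (m - j)) := by
    intro j
    by_cases hj : j < m
    · obtain ⟨C, hC0, hC⟩ := exists_abs_iteratedDeriv_pow_le hψ hψ0 hψs hj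
      exact ⟨C, hC0, fun _ => hC⟩
    · exact ⟨0, le_rfl, fun h => absurd h hj⟩
  choose C hC0 hC using hex
  set S := ∑ j ∈ Finset.range m, C j with hS
  have hS0 : 0 ≤ S := Finset.sum_nonneg fun j _ => hC0 j
  have hCS : ∀ j, j < m → C j ≤ S := fun j hj =>
    Finset.single_le_sum (fun i _ => hC0 i) (Finset.mem_range.2 hj)
  have hbd : ∀ j, j < m → ∀ u, |iteratedDeriv j (fun u => ψ u ^ m) u| ≤ S * ψ u ^ (m - j) :=
    fun j hj u => (hC j hj u).trans
      (mul_le_mul_of_nonneg_right (hCS j hj) (pow_nonneg (hψ0 u) _))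
  have hbd1 : ∀ j, j < m → ∀ u, |iteratedDeriv j (fun u => ψ u ^ m) u| ≤ S := fun j hj u =>
    (hbd j hj u).trans (mul_le_of_le_one_right hS0 (pow_le_one₀ (hψ0 u) (hψ1 u)))
  have hKc : ContDiff ℝ ∞ (fun u => ψ u ^ m) := hψ.pow m
  refine ⟨fun u => ψ u ^ m, 2 * S + 1, by linarith, hKc, fun u => pow_nonneg (hψ0 u) _,
    fun u => pow_le_one₀ (hψ0 u) (hψ1 u), ?_, fun u hu => ?_, fun j hj u => ?_, fun u v => ?_⟩
  · have : ψ 0 = 1 := ψ.one_of_mem_closedBall (by simp [ψ])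
    simp [this]
  · dsimp only
    rw [hψs u hu, zero_pow (by omega)]
  · have hjm : j < m := by have := le_strictFloor hj; omega
    have hjm' : (j : ℝ) < m := by exact_mod_cast hjm
    calc |iteratedDeriv j (fun u => ψ u ^ m) u| ^ β ≤ (S * ψ u ^ (m - j)) ^ β :=
          Real.rpow_le_rpow (abs_nonneg _) (hbd j hjm u) hβ.le
      _ = S ^ β * ψ u ^ (((m : ℝ) - j) * β) := by
          rw [Real.mul_rpow hS0 (pow_nonneg (hψ0 u) _), ← Real.rpow_natCast, ← Real.rpow_mul (hψ0 u),
            Nat.cast_sub hjm.le]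
      _ ≤ (2 * S + 1) ^ β * ψ u ^ ((m : ℝ) * (β - j)) := by
          refine mul_le_mul (Real.rpow_le_rpow hS0 (by linarith) hβ.le) ?_
            (Real.rpow_nonneg (hψ0 u) _) (by positivity)
          refine Real.rpow_le_rpow_of_exponent_ge_of_imp (hψ0 u) (hψ1 u) ?_ ?_
          · have : (0 : ℝ) ≤ j := j.cast_nonneg
            nlinarith
          · intro _ h0
            exact absurd h0 (mul_pos (by linarith [(Nat.cast_nonneg j : (0 : ℝ) ≤ j)])
              (by linarith)).ne'
      _ = (2 * S + 1) ^ β * (ψ u ^ m) ^ (β - j) := by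
          rw [← Real.rpow_natCast (ψ u) m, ← Real.rpow_mul (hψ0 u)]
  · have hs0 : 0 < β - k := by linarith [strictFloor_lt hβ]
    have hs1 : β - k ≤ 1 := by linarith [le_strictFloor_add_one hβ]
    have hlip : |iteratedDeriv k (fun u => ψ u ^ m) u - iteratedDeriv k (fun u => ψ u ^ m) v| ≤
        S * |u - v| := by
      have hd : Differentiable ℝ (iteratedDeriv k (fun u => ψ u ^ m)) :=
        hKc.differentiable_iteratedDeriv k (by exact_mod_cast ENat.natCast_lt_top k)
      refine (convex_univ (𝕜 := ℝ) (E := ℝ)).norm_image_sub_le_of_norm_deriv_le (fun x _ => hd x)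
        (fun x _ => ?_) (mem_univ v) (mem_univ u)
      rw [← iteratedDeriv_succ]
      exact hbd1 (k + 1) (by omega) x
    rcases le_or_gt |u - v| 1 with h1 | h1
    · refine hlip.trans ?_
      have h2 : |u - v| ≤ |u - v| ^ (β - k) := by
        have := Real.rpow_le_rpow_of_exponent_ge_of_imp (abs_nonneg (u - v)) h1 hs1
          (fun _ h0 => absurd h0 one_ne_zero)
        rwa [Real.rpow_one] at this
      exact mul_le_mul (by linarith) h2 (abs_nonneg _) (by linarith)
    · have h2 : 1 ≤ |u - v| ^ (β - k) := Real.one_le_rpow h1.le hs0.le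
      have h3 := abs_sub (iteratedDeriv k (fun u => ψ u ^ m) u)
        (iteratedDeriv k (fun u => ψ u ^ m) v)
      have h4 := hbd1 k (by omega) u
      have h5 := hbd1 k (by omega) v
      nlinarith

/-- The rescaling `h ^ β * K ((x - x₀) / h)` leaves the Hölder and flatness seminorms invariant, so
its flat norm is bounded uniformly in `h ≤ 1`. -/
theorem exists_scaled_flat_bump {β : ℝ} (hβ : 0 < β) :
    ∃ (K : ℝ → ℝ) (B : ℝ), 0 < B ∧ ContDiff ℝ ∞ K ∧ (∀ u, 0 ≤ K u) ∧ (∀ u, K u ≤ 1) ∧ K 0 = 1 ∧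
      (∀ u, 1 ≤ |u| → K u = 0) ∧
      ∀ γ h x₀ : ℝ, 0 ≤ γ → 0 < h → h ≤ 1 →
        flatNorm β (fun x => γ * h ^ β * K (h⁻¹ * (x - x₀))) ≤ ENNReal.ofReal (γ * B) := by
  obtain ⟨K, A, hA, hK, hK0, hK1, hK00, hKs, hKd, hKh⟩ := exists_flat_bump hβ
  have hA0 : 0 < A := by linarith
  refine ⟨K, 1 + A + A + A ^ β, by positivity, hK, hK0, hK1, hK00, hKs,
    fun γ h x₀ hγ hh hh1 => ?_⟩
  set φ : ℝ → ℝ := fun x => γ * h ^ β * K (h⁻¹ * (x - x₀)) with hφ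
  have hφc : ContDiff ℝ ∞ φ := by fun_prop
  have hder : ∀ j : ℕ, ∀ x ∈ Icc (0 : ℝ) 1,
      derivI j φ x = γ * h ^ (β - j) * iteratedDeriv j K (h⁻¹ * (x - x₀)) := by
    intro j x hx
    have hc : ContDiff ℝ j φ := hφc.of_le (by exact_mod_cast le_top)
    have hKj : ContDiff ℝ j K := hK.of_le (by exact_mod_cast le_top)
    rw [derivI, iteratedDerivWithin_eq_iteratedDeriv (uniqueDiffOn_Icc zero_lt_one)
      hc.contDiffAt hx, hφ, iteratedDeriv_const_mul_field,
      iteratedDeriv_comp_sub_const j (fun z => K (h⁻¹ * z)) x₀, iteratedDeriv_comp_const_mul hKj,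
      Real.rpow_sub hh, Real.rpow_natCast, inv_pow]
    field_simp
  have hKb : ∀ j : ℕ, (j : ℝ) < β → ∀ u, |iteratedDeriv j K u| ≤ A := by
    intro j hj u
    have h1 : |iteratedDeriv j K u| ^ β ≤ A ^ β := (hKd j hj u).trans
      (mul_le_of_le_one_right (by positivity) (Real.rpow_le_one (hK0 u) (hK1 u) (by linarith)))
    exact (Real.rpow_le_rpow_iff (abs_nonneg _) hA0.le hβ).1 h1
  have hkβ := strictFloor_lt hβ
  have hsup1 : supNorm φ ≤ ENNReal.ofReal (γ * 1) := by
    refine iSup₂_le fun x hx => ?_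
    rw [Real.enorm_of_nonneg (mul_nonneg (by positivity) (hK0 _))]
    refine ENNReal.ofReal_le_ofReal ?_
    rw [mul_assoc]
    have := hK0 (h⁻¹ * (x - x₀))
    have h1 : h ^ β ≤ 1 := Real.rpow_le_one hh.le hh1 hβ.le
    have h2 := hK1 (h⁻¹ * (x - x₀))
    have h3 : h ^ β * K (h⁻¹ * (x - x₀)) ≤ 1 := mul_le_one₀ h1 this h2
    gcongr
  have hsup2 : supNorm (derivI (strictFloor β) φ) ≤ ENNReal.ofReal (γ * A) := by
    refine iSup₂_le fun x hx => ?_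
    rw [hder _ x hx, ← ofReal_norm]
    refine ENNReal.ofReal_le_ofReal ?_
    have h1 : h ^ (β - strictFloor β) ≤ 1 := Real.rpow_le_one hh.le hh1 (by linarith)
    rw [norm_mul, Real.norm_of_nonneg (by positivity : 0 ≤ γ * h ^ (β - strictFloor β)), mul_assoc]
    have h2 := hKb _ hkβ (h⁻¹ * (x - x₀))
    have h3 : h ^ (β - strictFloor β) * ‖iteratedDeriv (strictFloor β) K (h⁻¹ * (x - x₀))‖ ≤
        1 * A := by
      gcongr
      exact h2
    rw [one_mul] at h3
    gcongr
  have hhol : holderSeminorm β φ ≤ ENNReal.ofReal (γ * A) := by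
    refine iSup₂_le fun x hx => iSup₂_le fun y hy => iSup_le fun hxy => ?_
    refine ENNReal.ofReal_le_ofReal ?_
    have hxy' : 0 < |x - y| := abs_pos.2 (sub_ne_zero.2 hxy)
    rw [hder _ x hx, hder _ y hy, ← mul_sub, abs_mul,
      abs_of_nonneg (by positivity : 0 ≤ γ * h ^ (β - strictFloor β)), div_le_iff₀ (by positivity)]
    have h1 := hKh (h⁻¹ * (x - x₀)) (h⁻¹ * (y - x₀))
    have h2 : h⁻¹ * (x - x₀) - h⁻¹ * (y - x₀) = h⁻¹ * (x - y) := by ring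
    rw [h2, abs_mul, abs_of_pos (inv_pos.2 hh), Real.mul_rpow (by positivity) hxy'.le,
      Real.inv_rpow hh.le] at h1
    have h3 : 0 < h ^ (β - strictFloor β) := by positivity
    calc _ ≤ γ * h ^ (β - strictFloor β) *
          (A * ((h ^ (β - strictFloor β))⁻¹ * |x - y| ^ (β - strictFloor β))) := by gcongr
      _ = γ * A * |x - y| ^ (β - strictFloor β) := by field_simp
  have hflat : flatSeminorm β φ ≤ ENNReal.ofReal (γ * A ^ β) := by
    rw [flatSeminorm_le_iff ENNReal.ofReal_ne_top]
    intro j hj hjβ x hx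
    have hj0 : (0 : ℝ) < β - j := by linarith
    rw [hder j x hx, ← ofReal_norm, ← ofReal_norm,
      ENNReal.ofReal_rpow_of_nonneg (norm_nonneg _) hβ.le,
      ENNReal.ofReal_rpow_of_nonneg (norm_nonneg _) hj0.le,
      ← ENNReal.ofReal_pow (by positivity), ← ENNReal.ofReal_mul (by positivity)]
    refine ENNReal.ofReal_le_ofReal ?_
    set u := h⁻¹ * (x - x₀) with hu
    have hKu := hK0 u
    rw [norm_mul, Real.norm_of_nonneg (by positivity : 0 ≤ γ * h ^ (β - j)),
      Real.norm_of_nonneg (mul_nonneg (by positivity) (hK0 _)), ← hu,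
      Real.mul_rpow (by positivity) (norm_nonneg _), Real.mul_rpow (by positivity) hKu,
      Real.mul_rpow hγ (by positivity), Real.mul_rpow hγ (by positivity), ← Real.rpow_mul hh.le,
      ← Real.rpow_mul hh.le, mul_comm (β - (j : ℝ)) β]
    have hγβ : γ ^ β = γ ^ j * γ ^ (β - j) := by
      rcases hγ.eq_or_lt with rfl | hγ'
      · rw [Real.zero_rpow hβ.ne', zero_pow (by omega), zero_mul]
      · rw [← Real.rpow_natCast, ← Real.rpow_add hγ']
        congr 1
        ring
    have hAj : A ^ β ≤ (A ^ β) ^ j := le_self_pow₀ (Real.one_le_rpow hA hβ.le) (by omega)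
    calc γ ^ β * h ^ (β * (β - j)) * ‖iteratedDeriv j K u‖ ^ β
        ≤ γ ^ β * h ^ (β * (β - j)) * ((A ^ β) ^ j * K u ^ (β - j)) := by
          gcongr
          refine (hKd j hjβ u).trans ?_
          gcongr
      _ = (γ * A ^ β) ^ j * (γ ^ (β - j) * h ^ (β * (β - j)) * K u ^ (β - j)) := by
          rw [hγβ, mul_pow]
          ring
  unfold flatNorm holderNorm
  calc _ ≤ ENNReal.ofReal (γ * 1) + ENNReal.ofReal (γ * A) + ENNReal.ofReal (γ * A) +
        ENNReal.ofReal (γ * A ^ β) := by gcongr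
    _ = ENNReal.ofReal (γ * (1 + A + A + A ^ β)) := by
        rw [← ENNReal.ofReal_add (by positivity) (by positivity),
          ← ENNReal.ofReal_add (by positivity) (by positivity),
          ← ENNReal.ofReal_add (by positivity) (by positivity)]
        congr 1
        ring

end FlatBump

/-! ### The alternative and the lower bound -/

theorem sq_sqrt_add_sub_sqrt_le {a b : ℝ} (ha : 0 ≤ a) (hb : 0 ≤ b) :
    (√(a + b) - √a) ^ 2 ≤ b := by
  have h1 := Real.sq_sqrt ha
  have h2 := Real.sq_sqrt (add_nonneg ha hb)
  have h3 : √a ≤ √(a + b) := Real.sqrt_le_sqrt (by linarith)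
  nlinarith [Real.sqrt_nonneg a]

theorem sq_sqrt_add_sub_sqrt_le_div {a b : ℝ} (ha : 0 < a) (hb : 0 ≤ b) :
    (√(a + b) - √a) ^ 2 ≤ b ^ 2 / (4 * a) := by
  have h1 := Real.sq_sqrt ha.le
  have h2 := Real.sq_sqrt (add_nonneg ha.le hb)
  have h3 : √a ≤ √(a + b) := Real.sqrt_le_sqrt (by linarith)
  have h4 : 2 * √a * (√(a + b) - √a) ≤ b := by nlinarith
  have h5 : 0 ≤ 2 * √a * (√(a + b) - √a) :=
    mul_nonneg (by positivity) (sub_nonneg.2 h3)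
  rw [le_div_iff₀ (by positivity)]
  calc (√(a + b) - √a) ^ 2 * (4 * a) = (2 * √a * (√(a + b) - √a)) ^ 2 := by
        rw [mul_pow, mul_pow, h1]
        ring
    _ ≤ b ^ 2 := by gcongr

/-- The rate as a single power: the two branches agree at the threshold value `n ^ (-β / (β + 1))`. -/
theorem localRate_eq {n : ℕ} (hn : n ≠ 0) {β v : ℝ} (hβ : 0 < β) (hv : 0 ≤ v) :
    localRate n β v =
      (max v ((n : ℝ) ^ (-(β / (β + 1)))) / n) ^ (β / (2 * β + 1)) := by
  have hn0 : (0 : ℝ) < n := by exact_mod_cast Nat.pos_of_ne_zero hn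
  have hthr : ((n : ℝ) ^ (-(β / (β + 1))) / n) ^ (β / (2 * β + 1)) = (n : ℝ) ^ (-(β / (β + 1))) := by
    rw [← Real.rpow_sub_one hn0.ne', ← Real.rpow_mul hn0.le]
    congr 1
    field_simp
    ring
  have hmono : Monotone fun u : ℝ => (max u 0 / n) ^ (β / (2 * β + 1)) := by
    intro a b hab
    dsimp only
    gcongr
  have h := hmono.map_max (a := v) (b := (n : ℝ) ^ (-(β / (β + 1))))
  have hp : 0 ≤ (n : ℝ) ^ (-(β / (β + 1))) := by positivity
  simp only [max_eq_left (le_max_of_le_left hv : 0 ≤ max v ((n : ℝ) ^ (-(β / (β + 1))))),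
    max_eq_left hv, max_eq_left hp] at h
  rw [localRate, h, hthr, max_comm]

theorem setIntegral_le_of_local {F : ℝ → ℝ} (hF : ContinuousOn F (Icc 0 1)) {x₀ δ D : ℝ}
    (hδ : 0 ≤ δ) (hD : 0 ≤ D) (hin : ∀ x ∈ Icc (0 : ℝ) 1, |x - x₀| ≤ δ → F x ≤ D)
    (hout : ∀ x ∈ Icc (0 : ℝ) 1, δ < |x - x₀| → F x ≤ 0) :
    ∫ x in Icc (0 : ℝ) 1, F x ≤ 2 * δ * D := by
  have hI : Integrable ((Icc (x₀ - δ) (x₀ + δ)).indicator fun _ => D) volume :=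
    (integrable_indicator_iff measurableSet_Icc).2 (integrableOn_const (by simp))
  calc ∫ x in Icc (0 : ℝ) 1, F x
      ≤ ∫ x in Icc (0 : ℝ) 1, (Icc (x₀ - δ) (x₀ + δ)).indicator (fun _ => D) x := by
        refine setIntegral_mono_on (hF.integrableOn_compact isCompact_Icc) hI.integrableOn
          measurableSet_Icc fun x hx => ?_
        by_cases hxx : |x - x₀| ≤ δ
        · have h1 := abs_le.1 hxx
          rw [indicator_of_mem (mem_Icc.2 ⟨by linarith, by linarith⟩)]
          exact hin x hx hxx
        · refine (hout x hx (not_le.1 hxx)).trans (indicator_nonneg (fun _ _ => hD) x)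
    _ ≤ ∫ x, (Icc (x₀ - δ) (x₀ + δ)).indicator (fun _ => D) x :=
        setIntegral_le_integral hI (ae_of_all _ fun x => indicator_nonneg (fun _ _ => hD) x)
    _ = 2 * δ * D := by
        rw [integral_indicator measurableSet_Icc, setIntegral_const,
          Real.volume_real_Icc_of_le (by linarith), smul_eq_mul]
        ring

/-- Le Cam's two-point bound: one of two events covering the whole space is likely. -/
theorem ofReal_exp_neg_four_le_max {α : Type*} [MeasurableSpace α] {μ ν : Measure α}
    [IsProbabilityMeasure μ] [IsProbabilityMeasure ν] (h : klDiv μ ν ≤ 1) {A B : Set α}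
    (hAB : A ∪ B = univ) : ENNReal.ofReal (Real.exp (-4)) ≤ max (ν A) (μ B) := by
  rcases le_or_gt (1 / 2) (μ.real A) with hA | hA
  · refine le_max_of_le_left ?_
    rw [← ofReal_measureReal (μ := ν)]
    exact ENNReal.ofReal_le_ofReal (exp_neg_four_le_of_klDiv_le_one h hA)
  · refine le_max_of_le_right ?_
    rw [← ofReal_measureReal (μ := μ)]
    refine ENNReal.ofReal_le_ofReal ?_
    have h1 : μ.real (A ∪ B) = 1 := by rw [hAB, probReal_univ]
    have h2 := measureReal_union_le (μ := μ) A B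
    have h3 : Real.exp (-4) ≤ 1 / 2 := by
      rw [Real.exp_neg, one_div]
      exact inv_anti₀ two_pos (by linarith [Real.add_one_le_exp (4 : ℝ)])
    linarith

theorem measurable_observation {Ω : Type*} [MeasurableSpace Ω] {W : ℝ≥0 → Ω → ℝ}
    (hWm : ∀ t, Measurable (W t)) (n : ℕ) (f : ℝ → ℝ) : Measurable (observation W n f) :=
  measurable_pi_lambda _ fun _ => ((hWm _).const_mul _).const_add _

open scoped ContDiff in
/-- The least favourable alternative `g = f + γ δ ^ β K ((· - x₀) / δ)`, where
`δ = c (v / n) ^ (1 / (2 β + 1))` and `v` is the larger of `f x₀` and the threshold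
`n ^ (-β / (β + 1))`. It stays in the parameter space and within divergence one of `f`, yet its value
at `x₀` differs from `f x₀` by a multiple of the rate. -/
theorem exists_alternative {β R R' : ℝ} (hβ : 0 < β) (hR' : 0 < R') (hRR : R' < R) :
    ∃ C : ℝ, 0 < C ∧ ∀ n : ℕ, n ≠ 0 → R' ≤ n → ∀ f ∈ FlatHolder β,
      flatNorm β f ≤ ENNReal.ofReal R' → ∀ x₀ ∈ Icc (0 : ℝ) 1,
      ∃ g ∈ FlatHolder β, flatNorm β g ≤ ENNReal.ofReal R ∧
        2 * n * ∫ s in Icc (0 : ℝ) 1, (√(g s) - √(f s)) ^ 2 ≤ 1 ∧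
        C * (localRate n β (f x₀) + localRate n β (g x₀)) ≤ |g x₀ - f x₀| := by
  obtain ⟨c, κ, hc0, hc1, hκ0, hκ1, hlow⟩ := exists_lower_bound_of_flatNorm_le hβ hR'
  obtain ⟨K, B, hB, hK, hK0, hK1, hK00, hKs, hKn⟩ := exists_scaled_flat_bump hβ
  set γ := min (κ / 4) ((R - R') / B) with hγ
  have hγ0 : 0 < γ := lt_min (by positivity) (div_pos (by linarith) hB)
  have hγκ : γ ≤ κ / 4 := min_le_left _ _
  have hγ1 : γ ≤ 1 / 4 := by linarith
  have hγB : γ * B ≤ R - R' := (le_div_iff₀ hB).1 (min_le_right _ _)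
  refine ⟨γ * c ^ β / 3, by positivity, fun n hn hnR f hf hfR x₀ hx₀ => ?_⟩
  have hn0 : (0 : ℝ) < n := by exact_mod_cast Nat.pos_of_ne_zero hn
  have hn1 : (1 : ℝ) ≤ n := by exact_mod_cast Nat.one_le_iff_ne_zero.2 hn
  obtain ⟨hfc, hf0, hftop⟩ := hf
  have hfx₀ := hf0 x₀ hx₀
  set τ := (n : ℝ) ^ (-(β / (β + 1))) with hτ
  have hτ0 : 0 < τ := by positivity
  have hτ1 : τ ≤ 1 := Real.rpow_le_one_of_one_le_of_nonpos hn1 (by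
    rw [neg_nonpos]; positivity)
  set v := max (f x₀) τ with hv
  have hv0 : 0 < v := lt_max_of_lt_right hτ0
  have hvn : v ≤ n := max_le ((le_of_flatNorm_le hR'.le hfR hx₀).trans hnR) (hτ1.trans hn1)
  set h := (v / n) ^ (1 / (2 * β + 1)) with hh
  have hh0 : 0 < h := by positivity
  have hh1 : h ≤ 1 := Real.rpow_le_one (by positivity) ((div_le_one hn0).2 hvn) (by positivity)
  have hhβ : h ^ β = (v / n) ^ (β / (2 * β + 1)) := by
    rw [hh, ← Real.rpow_mul (by positivity)]
    congr 1
    field_simp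
  have hh2 : n * h ^ (2 * β + 1) = v := by
    rw [hh, ← Real.rpow_mul (by positivity), one_div, inv_mul_cancel₀ (by positivity), Real.rpow_one]
    field_simp
  -- The perturbation is not larger than `v`; equivalently `h ≤ v ^ (1 / β)`, the scale on which `f`
  -- keeps its size.
  have hhv : h ^ β ≤ v := by
    rw [hhβ]
    have h1 : v / n ≤ v ^ ((2 * β + 1) / β) := by
      have h2 : (n : ℝ)⁻¹ ≤ v ^ ((β + 1) / β) := by
        calc (n : ℝ)⁻¹ = τ ^ ((β + 1) / β) := by
              rw [hτ, ← Real.rpow_mul hn0.le, ← Real.rpow_neg_one]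
              congr 1
              field_simp
          _ ≤ v ^ ((β + 1) / β) := by
              gcongr
              exact le_max_right _ _
      calc v / n = v * (n : ℝ)⁻¹ := div_eq_mul_inv _ _
        _ ≤ v * v ^ ((β + 1) / β) := by gcongr
        _ = v ^ ((2 * β + 1) / β) := by
            rw [← Real.rpow_one_add' hv0.le (by positivity)]
            congr 1
            field_simp
            ring
    calc (v / n) ^ (β / (2 * β + 1)) ≤ (v ^ ((2 * β + 1) / β)) ^ (β / (2 * β + 1)) := by gcongr
      _ = v := by
          rw [← Real.rpow_mul hv0.le]
          have : (2 * β + 1) / β * (β / (2 * β + 1)) = 1 := by field_simp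
          rw [this, Real.rpow_one]
  have hrf : localRate n β (f x₀) = h ^ β := by rw [localRate_eq hn hβ hfx₀, hhβ]
  set δ := c * h with hδ
  have hδ0 : 0 < δ := by positivity
  have hδ1 : δ ≤ 1 := mul_le_one₀ hc1 hh0.le hh1
  set φ : ℝ → ℝ := fun x => γ * δ ^ β * K (δ⁻¹ * (x - x₀)) with hφ
  have hφc : ContDiff ℝ ∞ φ := by fun_prop
  have hφc' : ContDiffOn ℝ (strictFloor β : ℕ) φ (Icc 0 1) :=
    (hφc.of_le (by exact_mod_cast le_top)).contDiffOn
  have hφ0 : ∀ x, 0 ≤ φ x := fun x => mul_nonneg (by positivity) (hK0 _)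
  have hφle : ∀ x, φ x ≤ γ * δ ^ β := fun x => mul_le_of_le_one_right (by positivity) (hK1 _)
  have hφx₀ : φ x₀ = γ * δ ^ β := by simp [hφ, hK00]
  have hφs : ∀ x, δ < |x - x₀| → φ x = 0 := by
    intro x hx
    have : 1 ≤ |δ⁻¹ * (x - x₀)| := by
      rw [abs_mul, abs_of_pos (inv_pos.2 hδ0), inv_mul_eq_div, one_le_div hδ0]
      exact hx.le
    simp [hφ, hKs _ this]
  have hδβ : δ ^ β = c ^ β * h ^ β := Real.mul_rpow hc0.le hh0.le
  have hcβ : c ^ β ≤ 1 := Real.rpow_le_one hc0.le hc1 hβ.le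
  have hδh : γ * δ ^ β ≤ h ^ β := by
    rw [hδβ]
    have : γ * c ^ β ≤ 1 := mul_le_one₀ (by linarith) (by positivity) hcβ
    calc γ * (c ^ β * h ^ β) = (γ * c ^ β) * h ^ β := by ring
      _ ≤ 1 * h ^ β := by gcongr
      _ = h ^ β := one_mul _
  have hgnorm : flatNorm β (fun x => f x + φ x) ≤ ENNReal.ofReal R := by
    refine (flatNorm_add_le hfc hφc' hf0 fun x _ => hφ0 x).trans ?_
    refine (add_le_add hfR (hKn γ δ x₀ hγ0.le hδ0 hδ1)).trans ?_
    rw [← ENNReal.ofReal_add hR'.le (by positivity)]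
    exact ENNReal.ofReal_le_ofReal (by linarith)
  refine ⟨fun x => f x + φ x, ⟨hfc.add hφc', fun x hx => add_nonneg (hf0 x hx) (hφ0 x),
    hgnorm.trans_lt ENNReal.ofReal_lt_top⟩, hgnorm, ?_, ?_⟩
  · have hfcont : ContinuousOn f (Icc 0 1) := hfc.continuousOn
    have hφcont : Continuous φ := hφc.continuous
    have hFc : ContinuousOn (fun s => (√(f s + φ s) - √(f s)) ^ 2) (Icc 0 1) := by fun_prop
    have hout : ∀ x ∈ Icc (0 : ℝ) 1, δ < |x - x₀| → (√(f x + φ x) - √(f x)) ^ 2 ≤ 0 := by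
      intro x _ hx
      simp [hφs x hx]
    rcases le_total (f x₀) τ with hsmall | hlarge
    -- Below the threshold `f` may vanish near `x₀`, and `(√(a + b) - √a)² ≤ b` is used.
    · have hvτ : v = τ := max_eq_right hsmall
      have hhτ : h ^ β = τ := by
        rw [hhβ, hvτ, hτ, ← Real.rpow_sub_one hn0.ne', ← Real.rpow_mul hn0.le]
        congr 1
        field_simp
        ring
      have hnh : n * (h ^ β * h) = 1 := by
        have h1 : h ^ (2 * β + 1) = h ^ β * (h ^ β * h) := by
          rw [← Real.rpow_add_one hh0.ne', ← Real.rpow_add hh0]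
          congr 1
          ring
        rw [h1, hvτ, ← hhτ] at hh2
        have h2 : 0 < h ^ β := by positivity
        have h3 : h ^ β * (n * (h ^ β * h)) = h ^ β * 1 := by linarith
        exact mul_left_cancel₀ h2.ne' h3
      have hint := setIntegral_le_of_local hFc (x₀ := x₀) (D := γ * δ ^ β) hδ0.le (by positivity)
        (fun x hx _ => (sq_sqrt_add_sub_sqrt_le (hf0 x hx) (hφ0 x)).trans (hφle x)) hout
      calc _ ≤ 2 * n * (2 * δ * (γ * δ ^ β)) := by gcongr
        _ = 4 * γ * (c ^ β * c) * (n * (h ^ β * h)) := by rw [hδβ, hδ]; ring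
        _ ≤ 4 * (1 / 4) * (1 * 1) * 1 := by
            rw [hnh]
            gcongr
        _ = 1 := by norm_num
    -- Above it `f ≥ κ v` on the support of the perturbation, and `(√(a + b) - √a)² ≤ b² / (4 a)`.
    · have hvf : v = f x₀ := max_eq_left hlarge
      have hδv : δ ≤ c * f x₀ ^ (1 / β) := by
        rw [hδ, ← hvf]
        gcongr
        have h1 := Real.rpow_le_rpow (by positivity) hhv (inv_nonneg.2 hβ.le)
        rwa [Real.rpow_rpow_inv hh0.le hβ.ne', ← one_div] at h1
      have hint := setIntegral_le_of_local hFc (x₀ := x₀) (D := (γ * δ ^ β) ^ 2 / (4 * (κ * v)))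
        hδ0.le (by positivity) (fun x hx hxx => by
          have h1 := hlow f ⟨hfc, hf0, hftop⟩ hfR x₀ hx₀ x hx (hxx.trans hδv)
          rw [← hvf] at h1
          have h2 : 0 < κ * v := by positivity
          refine (sq_sqrt_add_sub_sqrt_le_div (h2.trans_le h1) (hφ0 x)).trans ?_
          have h3 := hφle x
          have h4 := hφ0 x
          gcongr) hout
      have h1 : h ^ (2 * β + 1) = h ^ β * (h ^ β * h) := by
        rw [← Real.rpow_add_one hh0.ne', ← Real.rpow_add hh0]
        congr 1
        ring
      calc _ ≤ 2 * n * (2 * δ * ((γ * δ ^ β) ^ 2 / (4 * (κ * v)))) := by gcongr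
        _ = (γ / κ) * γ * (c * (c ^ β) ^ 2) * (n * h ^ (2 * β + 1)) / v := by
            rw [hδβ, hδ, h1]
            field_simp
            ring
        _ = (γ / κ) * γ * (c * (c ^ β) ^ 2) := by
            rw [hh2]
            field_simp
        _ ≤ 1 * 1 * (1 * 1 ^ 2) := by
            have : γ / κ ≤ 1 := (div_le_one hκ0).2 (by linarith)
            gcongr
            linarith
        _ = 1 := by norm_num
  · have hg0 : 0 ≤ f x₀ + φ x₀ := add_nonneg hfx₀ (hφ0 x₀)
    have hvx : f x₀ ≤ v := le_max_left _ _
    have hτv : τ ≤ v := le_max_right _ _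
    have hrg : localRate n β (f x₀ + φ x₀) ≤ 2 * h ^ β := by
      rw [localRate_eq hn hβ hg0, hhβ]
      have h1 : max (f x₀ + φ x₀) τ / n ≤ 2 * (v / n) := by
        rw [← mul_div_assoc]
        gcongr
        exact max_le (by linarith [hφle x₀]) (by linarith)
      have h2 : β / (2 * β + 1) ≤ 1 := (div_le_one (by positivity)).2 (by linarith)
      calc _ ≤ (2 * (v / n)) ^ (β / (2 * β + 1)) := by gcongr
        _ = 2 ^ (β / (2 * β + 1)) * (v / n) ^ (β / (2 * β + 1)) :=
            Real.mul_rpow two_pos.le (by positivity)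
        _ ≤ 2 * (v / n) ^ (β / (2 * β + 1)) := by
            gcongr
            exact Real.rpow_le_self_of_one_le one_le_two h2
    dsimp only
    rw [hrf, add_sub_cancel_left, abs_of_nonneg (hφ0 x₀)]
    calc _ ≤ γ * c ^ β / 3 * (h ^ β + 2 * h ^ β) := by gcongr
      _ = φ x₀ := by rw [hφx₀, hδβ]; ring

theorem theorem2 (β R ρ : ℝ) (hβ : 0 < β) (hR : 0 < R) (hρ0 : 0 ≤ ρ) (hρ : ρ < R) :
    ∃ C : ℝ, 0 < C ∧
      ∀ (Ω : Type*) [MeasurableSpace Ω] (P : Measure Ω) [IsProbabilityMeasure P]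
        (W : ℝ≥0 → Ω → ℝ) (_ : ∀ t, Measurable (W t)) (_ : IsBrownianReal W P)
        (x₀ : ℝ) (_ : x₀ ∈ Icc (0 : ℝ) 1)
        (fstar : ℕ → ℝ → ℝ) (_ : ∀ n, fstar n ∈ FlatHolder β)
        (_ : limsup (fun n => flatNorm β (fstar n)) atTop ≤ ENNReal.ofReal ρ),
        0 < liminf (fun n : ℕ => localMinimaxRisk P W n β R C x₀ (fstar n)) atTop := by
  obtain ⟨C, hC, hmain⟩ := exists_alternative (R := R) (R' := (ρ + R) / 2) hβ (by linarith)
    (by linarith)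
  refine ⟨C, hC, fun Ω _ P _ W hWm hW x₀ hx₀ fstar hf hlim => ?_⟩
  have hev : ∀ᶠ n in atTop, flatNorm β (fstar n) < ENNReal.ofReal ((ρ + R) / 2) :=
    eventually_lt_of_limsup_lt (hlim.trans_lt
      ((ENNReal.ofReal_lt_ofReal_iff (by linarith)).2 (by linarith)))
  have hprob : ∀ (n : ℕ) (f : ℝ → ℝ), IsProbabilityMeasure (observationLaw P W n f) := fun n f =>
    Measure.isProbabilityMeasure_map (measurable_observation hWm n f).aemeasurable
  have hpos : 0 < ENNReal.ofReal (Real.exp (-4)) := ENNReal.ofReal_pos.2 (Real.exp_pos _)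
  refine hpos.trans_le (le_liminf_of_le (by isBoundedDefault) ?_)
  filter_upwards [hev, eventually_ge_atTop 1, eventually_ge_atTop ⌈(ρ + R) / 2⌉₊] with n hnf hn1 hnR
  have hn : n ≠ 0 := by omega
  have hn0 : (0 : ℝ) < n := by exact_mod_cast Nat.pos_of_ne_zero hn
  obtain ⟨g, hg, hgR, hint, hsep⟩ := hmain n hn (Nat.ceil_le.1 hnR) (fstar n) (hf n) hnf.le x₀ hx₀
  have hkl : klDiv (observationLaw P W n g) (observationLaw P W n (fstar n)) ≤ 1 := by
    refine (klDiv_observationLaw_le hWm hW.toIsPreBrownianReal hn hg.1.continuousOn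
      (hf n).1.continuousOn).trans ?_
    rw [← ENNReal.ofReal_one]
    exact ENNReal.ofReal_le_ofReal hint
  have hfmem : fstar n ∈ localClass P W n β R (fstar n) :=
    ⟨hf n, hnf.le.trans (ENNReal.ofReal_le_ofReal (by linarith)), by
      rw [klDiv_self]; exact zero_le⟩
  have hgmem : g ∈ localClass P W n β R (fstar n) := ⟨hg, hgR, hkl⟩
  have hrate : ∀ v, 0 < localRate n β v := fun v => lt_max_of_lt_left (by positivity)
  refine le_iInf₂ fun est hest => ?_
  refine (ofReal_exp_neg_four_le_max hkl
    (A := {y | C ≤ |est y - fstar n x₀| / localRate n β (fstar n x₀)})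
    (B := {y | C ≤ |est y - g x₀| / localRate n β (g x₀)}) ?_).trans (max_le ?_ ?_)
  · refine eq_univ_of_forall fun y => ?_
    by_contra hy
    simp only [mem_union, mem_ofPred_eq, not_or, not_le, div_lt_iff₀ (hrate _)] at hy
    have h1 := abs_sub_le (g x₀) (est y) (fstar n x₀)
    rw [abs_sub_comm (g x₀) (est y)] at h1
    linarith [hy.1, hy.2]
  · exact le_iSup₂ (f := fun f (_ : f ∈ localClass P W n β R (fstar n)) =>
      observationLaw P W n f {y | C ≤ |est y - f x₀| / localRate n β (f x₀)}) (fstar n) hfmem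
  · exact le_iSup₂ (f := fun f (_ : f ∈ localClass P W n β R (fstar n)) =>
      observationLaw P W n f {y | C ≤ |est y - f x₀| / localRate n β (f x₀)}) g hgmem
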